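/- Let $M$ be a smooth manifold with a foliation $\mathcal F$ of dimension $p$ and codimension $q$, let $N(M,\mathcal F)=TM/T\mathcal F$ be its normal bundle, and let $(D,g)$ be a foliated Hessian structure on $(M,\mathcal F)$: $D$ is a foliated, flat and torsion-free connection in $N(M,\mathcal F)$, and $g$ is a foliated Riemannian metric in $N(M,\mathcal F)$ which locally, in charts $(x^1,\dots,x^p,y^1,\dots,y^q)$ adapted to $\mathcal F$ and affine for $D$ (the sections $\overline{\partial/\partial y^i}$ are $D$-parallel), has the form $g=\sum_{i,j}\frac{\partial^2 h}{\partial y^i\partial y^j}\,dy^i\,dy^j$ for a basic function $h$ (one depending on $y$ only). Let $\nabla$ be the Levi-Civita connection of $g$ in the normal bundle, $\gamma=\nabla-D$, and let $Q=D\gamma$ be the normal Hessian curvature tensor, $Q^i{}_{jkl}=\partial\gamma^i_{jl}/\partial y^k$ in adapted affine charts. The Hessian normal sectional curvature is the function $$\mathbf q(\xi)=\frac{\langle\hat Q(\xi),\xi\rangle}{\langle\xi,\xi\rangle},\qquad \hat Q(\xi)^{ik}=\sum_{j,l}Q^i{}_j{}^k{}_l\,\xi^{jl},$$ of nonzero symmetric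 contravariant normal two-tensors $\xi$, where $\langle\cdot,\cdot\rangle$ is the inner product induced by $g$. On the manifold $N(M,\mathcal F)$ let $\mathcal F^N$ be the induced foliation of codimension $2q$: an adapted affine chart $(x,y)$ of $M$ induces the chart $(x,(y,v))$ of $N(M,\mathcal F)$, $v^i=dy^i$, in which the leaves of $\mathcal F^N$ are given by $(y,v)=\text{const}$. In the normal bundle of $\mathcal F^N$ let $J^N$ be the complex structure of the transverse holomorphic coordinates $z^i=y^i+\sqrt{-1}\,v^i$, and let $g^N=\sum_{i,j}g_{ij}(y)\,dz^i\,d\bar z^j=\sum_{i,j}g_{ij}(y)\,(dy^i\,dy^j+dv^i\,dv^j)$. The holomorphic normal sectional curvature of the Kähler structure $(N(M,\mathcal F),J^N,g^N;\mathcal F^N)$ is the sectional curvature of $g^N$ (computed with its Levi-Civita connection in the normal bundle of $\mathcal F^N$) on the planes spanned by $w$ and $J^Nw$, for nonzero vectors $w$ of that normal bundle. Then, for every $c\in\mathbb R$, the Hessian normal sectional curvature of $(M,\mathcal F,D,g)$ is constant equal to $c$ if and only if the holomorphic normal sectional curvature of $(N(M,\mathcal F),J^N,g^N;\mathcal F^N)$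 is constant equal to $-c$. -/

import Mathlib

open Set Topology
open scoped Manifold ContDiff Matrix

set_option linter.unusedSectionVars false

noncomputable section

namespace TransverseHessian

/-! ### Foliated manifolds -/

/-- The local model `ℝ^κ × ℝ^ι` of a foliated manifold: the first factor carries the coordinates
`x` along the leaves, the second factor the transverse coordinates `y`. -/
abbrev Model (κ ι : Type*) := (κ → ℝ) × (ι → ℝ)

section Foliated

variable {κ ι : Type*} [Fintype κ] [Fintype ι]

/-- The transverse partial derivative `∂f/∂y^i`. -/
def tderiv [DecidableEq ι] (i : ι) (f : Model κ ι → ℝ) (z : Model κ ι) : ℝ :=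
  fderiv ℝ f z (0, Pi.single i 1)

/-- A function is basic on `s` if its derivatives `∂f/∂x` along the leaves vanish on `s`. -/
def IsBasicOn (f : Model κ ι → ℝ) (s : Set (Model κ ι)) : Prop :=
  ∀ z ∈ s, ∀ a : κ → ℝ, fderiv ℝ f z (a, 0) = 0

/-- Smooth maps `(x, y) ↦ (a(x, y), b(y))` (the second component depending, locally, on `y`
only). -/
def IsFoliatedOn (f : Model κ ι → Model κ ι) (s : Set (Model κ ι)) : Prop :=
  ContDiffOn ℝ ∞ f s ∧ ∀ z ∈ s, ∀ a : κ → ℝ, (fderiv ℝ f z (a, 0)).2 = 0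

variable (κ ι) in
/-- The pregroupoid of smooth local maps of `ℝ^κ × ℝ^ι` that preserve the foliation by the
slices `y = const`. -/
def foliationPregroupoid : Pregroupoid (Model κ ι) where
  property f s := IsFoliatedOn f s
  comp := by
    intro f g u v hf hg hu hv huv
    refine ⟨hg.1.comp (hf.1.mono inter_subset_left) (fun x hx => hx.2), ?_⟩
    intro z hz a
    have h1 : DifferentiableAt ℝ f z :=
      (hf.1.contDiffAt (hu.mem_nhds hz.1)).differentiableAt (by simp)
    have h2 : DifferentiableAt ℝ g (f z) :=
      (hg.1.contDiffAt (hv.mem_nhds hz.2)).differentiableAt (by simp)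
    rw [fderiv_comp z h2 h1]
    have h3 := hf.2 z hz.1 a
    have h4 : fderiv ℝ f z (a, 0) = ((fderiv ℝ f z (a, 0)).1, 0) := Prod.ext rfl h3
    rw [ContinuousLinearMap.comp_apply, h4]
    exact hg.2 (f z) hz.2 _
  id_mem := ⟨contDiffOn_id, fun z _ a => by simp⟩
  locality := by
    intro f u hu h
    refine ⟨fun x hx => ?_, fun z hz a => ?_⟩
    · obtain ⟨v, hv, hxv, hf⟩ := h x hx
      exact (hf.1.contDiffAt ((hu.inter hv).mem_nhds ⟨hx, hxv⟩)).contDiffWithinAt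
    · obtain ⟨v, hv, hxv, hf⟩ := h z hz
      exact hf.2 z ⟨hz, hxv⟩ a
  congr := by
    intro f g u hu hfg hf
    refine ⟨hf.1.congr hfg, fun z hz a => ?_⟩
    have : g =ᶠ[𝓝 z] f := Filter.eventually_of_mem (hu.mem_nhds hz) hfg
    rw [this.fderiv_eq]
    exact hf.2 z hz a

variable (κ ι) in
/-- The groupoid of local diffeomorphisms of `ℝ^κ × ℝ^ι` that preserve the foliation by the
slices `y = const`. A manifold with an atlas for this groupoid is a manifold with a foliation
whose leaves have dimension `#κ` and whose codimension is `#ι`. -/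
def foliationGroupoid : StructureGroupoid (Model κ ι) :=
  (foliationPregroupoid κ ι).groupoid

variable (κ ι) in
/-- An indexed atlas of adapted charts of a foliation on `M`. -/
structure FoliatedAtlas (M : Type*) [TopologicalSpace M] (A : Type*) where
  chart : A → OpenPartialHomeomorph M (Model κ ι)
  exists_mem_source : ∀ x, ∃ i, x ∈ (chart i).source
  compatible : ∀ i j, (chart i).symm ≫ₕ chart j ∈ foliationGroupoid κ ι

variable (κ ι) in
/-- All adapted charts of a foliated manifold. -/
def adaptedAtlas (M : Type*) [TopologicalSpace M] [ChartedSpace (Model κ ι) M]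
    [HasGroupoid M (foliationGroupoid κ ι)] :
    FoliatedAtlas κ ι M ((foliationGroupoid κ ι).maximalAtlas M) where
  chart e := e.1
  exists_mem_source x :=
    ⟨⟨chartAt _ x, StructureGroupoid.chart_mem_maximalAtlas _ x⟩, mem_chart_source _ x⟩
  compatible e e' := StructureGroupoid.compatible_of_mem_maximalAtlas e.2 e'.2

namespace FoliatedAtlas

variable {M : Type*} [TopologicalSpace M] {A : Type*} (𝒜 : FoliatedAtlas κ ι M A)

/-- The change of coordinates from the chart `i` to the chart `j`. -/
def transition (i j : A) : OpenPartialHomeomorph (Model κ ι) (Model κ ι) :=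
  (𝒜.chart i).symm ≫ₕ 𝒜.chart j

/-- The transverse Jacobian matrix `∂y'^a/∂y^b` of the change of coordinates from the chart `i`
(coordinates `y`) to the chart `j` (coordinates `y'`). -/
def jacobian [DecidableEq ι] (i j : A) (z : Model κ ι) : Matrix ι ι ℝ :=
  Matrix.of fun a b => tderiv b (fun w => (𝒜.transition i j w).2 a) z

/-- The transverse derivative of the change of coordinates, as a linear map: this is the change
of the components, in the frames `∂̄/∂y^1, …, ∂̄/∂y^q`, of a vector of the normal bundle
`TM / TF`. -/
def normalDeriv (i j : A) (z : Model κ ι) : (ι → ℝ) →L[ℝ] (ι → ℝ) :=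
  ContinuousLinearMap.snd ℝ (κ → ℝ) (ι → ℝ) ∘L fderiv ℝ (𝒜.transition i j) z ∘L
    ContinuousLinearMap.inr ℝ (κ → ℝ) (ι → ℝ)

lemma isFoliatedOn (i j : A) :
    IsFoliatedOn (𝒜.transition i j) (𝒜.transition i j).source :=
  (mem_groupoid_of_pregroupoid.1 (𝒜.compatible i j)).1

lemma contDiffAt_transition (i j : A) {z : Model κ ι} (hz : z ∈ (𝒜.transition i j).source) :
    ContDiffAt ℝ ∞ (𝒜.transition i j) z :=
  (𝒜.isFoliatedOn i j).1.contDiffAt ((𝒜.transition i j).open_source.mem_nhds hz)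

lemma differentiableAt_transition (i j : A) {z : Model κ ι}
    (hz : z ∈ (𝒜.transition i j).source) : DifferentiableAt ℝ (𝒜.transition i j) z :=
  (𝒜.contDiffAt_transition i j hz).differentiableAt (by simp)

lemma transition_apply (i j : A) (z : Model κ ι) :
    𝒜.transition i j z = 𝒜.chart j ((𝒜.chart i).symm z) := rfl

lemma transition_symm (i j : A) : (𝒜.transition i j).symm = 𝒜.transition j i := rfl

lemma mem_transition_source {i j : A} {z : Model κ ι} :
    z ∈ (𝒜.transition i j).source ↔
      z ∈ (𝒜.chart i).target ∧ (𝒜.chart i).symm z ∈ (𝒜.chart j).source := by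
  simp [transition]

lemma mem_transition_source_of_mem {i j : A} {x : M} (hi : x ∈ (𝒜.chart i).source)
    (hj : x ∈ (𝒜.chart j).source) : 𝒜.chart i x ∈ (𝒜.transition i j).source := by
  rw [mem_transition_source]
  exact ⟨(𝒜.chart i).map_source hi, by rwa [(𝒜.chart i).left_inv hi]⟩

/-! ### The normal bundle -/

/-- The normal bundle `N(M, F) = TM / TF`: over an adapted chart it is trivialized by the frame
`∂̄/∂y^1, …, ∂̄/∂y^q`, and the changes of trivialization are the transverse derivatives of the
changes of charts. -/
def normalBundleCore : VectorBundleCore ℝ M (ι → ℝ) A where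
  baseSet i := (𝒜.chart i).source
  isOpen_baseSet i := (𝒜.chart i).open_source
  indexAt x := (𝒜.exists_mem_source x).choose
  mem_baseSet_at x := (𝒜.exists_mem_source x).choose_spec
  coordChange i j x := 𝒜.normalDeriv i j (𝒜.chart i x)
  coordChange_self i x hx v := by
    have h : 𝒜.transition i i =ᶠ[𝓝 (𝒜.chart i x)] id := by
      filter_upwards [(𝒜.chart i).open_target.mem_nhds ((𝒜.chart i).map_source hx)] with z hz
      simp [transition_apply, (𝒜.chart i).right_inv hz]
    simp [normalDeriv, h.fderiv_eq]
  continuousOn_coordChange i j := by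
    have h : ContinuousOn (fderiv ℝ (𝒜.transition i j)) (𝒜.transition i j).source :=
      (𝒜.isFoliatedOn i j).1.continuousOn_fderiv_of_isOpen (𝒜.transition i j).open_source
        (by simp)
    have h2 : ContinuousOn (fun x => fderiv ℝ (𝒜.transition i j) (𝒜.chart i x))
        ((𝒜.chart i).source ∩ (𝒜.chart j).source) :=
      h.comp ((𝒜.chart i).continuousOn.mono inter_subset_left)
        (fun x hx => 𝒜.mem_transition_source_of_mem hx.1 hx.2)
    exact continuousOn_const.clm_comp (h2.clm_comp continuousOn_const)
  coordChange_comp i j k x hx v := by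
    obtain ⟨⟨hi, hj⟩, hk⟩ := hx
    have hij := 𝒜.mem_transition_source_of_mem hi hj
    have hjk := 𝒜.mem_transition_source_of_mem hj hk
    have e1 : 𝒜.transition i j (𝒜.chart i x) = 𝒜.chart j x := by
      simp [transition_apply, (𝒜.chart i).left_inv hi]
    have h : 𝒜.transition i k =ᶠ[𝓝 (𝒜.chart i x)] 𝒜.transition j k ∘ 𝒜.transition i j := by
      filter_upwards [(𝒜.transition i j).open_source.mem_nhds hij] with z hz
      simp [transition_apply, (𝒜.chart j).left_inv (𝒜.mem_transition_source.1 hz).2]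
    have hd : DifferentiableAt ℝ (𝒜.transition j k) (𝒜.transition i j (𝒜.chart i x)) := by
      rw [e1]; exact 𝒜.differentiableAt_transition j k hjk
    simp only [normalDeriv, h.fderiv_eq,
      fderiv_comp _ hd (𝒜.differentiableAt_transition i j hij), e1,
      ContinuousLinearMap.comp_apply, ContinuousLinearMap.inr_apply,
      ContinuousLinearMap.coe_snd']
    set w := fderiv ℝ (𝒜.transition i j) (𝒜.chart i x) (0, v) with hw
    have h3 := (𝒜.isFoliatedOn j k).2 _ hjk w.1
    have h4 : w = (w.1, 0) + (0, w.2) := by simp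
    conv_rhs => rw [h4, map_add, Prod.snd_add, h3, zero_add]

/-- The total space of the normal bundle `N(M, F)`. -/
abbrev NormalBundle := 𝒜.normalBundleCore.TotalSpace

end FoliatedAtlas

variable [DecidableEq ι]

/-! ### Foliated tensors and connections, by components in adapted charts -/

/-- A foliated Riemannian metric in the normal bundle, `g = ∑ g_ij(y) dy^i dy^j` in every
adapted chart of the atlas. -/
structure FoliatedMetric {M A : Type*} [TopologicalSpace M] (𝒜 : FoliatedAtlas κ ι M A) where
  comp : A → Model κ ι → Matrix ι ι ℝ
  smooth : ∀ e i j, ContDiffOn ℝ ∞ (fun z => comp e z i j) (𝒜.chart e).target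
  basic : ∀ e i j, IsBasicOn (fun z => comp e z i j) (𝒜.chart e).target
  posDef : ∀ e, ∀ z ∈ (𝒜.chart e).target, (comp e z).PosDef
  transform : ∀ e e', ∀ z ∈ (𝒜.transition e e').source,
    comp e z = (𝒜.jacobian e e' z)ᵀ * comp e' (𝒜.transition e e' z) * 𝒜.jacobian e e' z

/-- A foliated connection `D` in the normal bundle: `D_X Ȳ = 0` for `X` tangent to the leaves and
`Ȳ` foliated, and `D_{∂/∂y^i} ∂̄/∂y^j = ∑_k Γ^k_ij(y) ∂̄/∂y^k`. Here `comp e z k i j` is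
`Γ^k_ij`. -/
structure FoliatedConnection {M A : Type*} [TopologicalSpace M]
    (𝒜 : FoliatedAtlas κ ι M A) where
  comp : A → Model κ ι → ι → ι → ι → ℝ
  smooth : ∀ e k i j, ContDiffOn ℝ ∞ (fun z => comp e z k i j) (𝒜.chart e).target
  basic : ∀ e k i j, IsBasicOn (fun z => comp e z k i j) (𝒜.chart e).target
  transform : ∀ e e', ∀ z ∈ (𝒜.transition e e').source, ∀ c i j,
    ∑ k, comp e z k i j * 𝒜.jacobian e e' z c k =
      tderiv i (fun w => 𝒜.jacobian e e' w c j) z +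
        ∑ a, ∑ b, 𝒜.jacobian e e' z a i * 𝒜.jacobian e e' z b j *
          comp e' (𝒜.transition e e' z) c a b

/-- Christoffel symbols `Γ^k_ij` (written `christoffel g z k i j`) of the Levi-Civita connection of
the metric `g = ∑ g_ij dy^i dy^j`. -/
def christoffel (g : Model κ ι → Matrix ι ι ℝ) (z : Model κ ι) (k i j : ι) : ℝ :=
  (1 / 2) * ∑ l, (g z)⁻¹ k l *
    (tderiv i (fun w => g w l j) z + tderiv j (fun w => g w l i) z -
      tderiv l (fun w => g w i j) z)

/-- Components `R^l_{kij}` (written `curvature Γ z l k i j`) of the curvature tensor of the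
connection with Christoffel symbols `Γ`:
`R(∂_i, ∂_j) ∂_k = D_i D_j ∂_k - D_j D_i ∂_k = ∑_l R^l_{kij} ∂_l`. -/
def curvature (Γ : Model κ ι → ι → ι → ι → ℝ) (z : Model κ ι) (l k i j : ι) : ℝ :=
  tderiv i (fun w => Γ w l j k) z - tderiv j (fun w => Γ w l i k) z +
    ∑ m, (Γ z l i m * Γ z m j k - Γ z l j m * Γ z m i k)

/-- The inner product of two vectors with respect to the matrix `g`. -/
def inner₁ (g : Matrix ι ι ℝ) (v w : ι → ℝ) : ℝ := ∑ i, ∑ j, g i j * v i * w j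

/-- The sectional curvature `g(R(v, w) w, v) / (g(v, v) g(w, w) - g(v, w)^2)` of the metric
`g = ∑ g_ij dy^i dy^j`. -/
def sectionalCurvature (g : Model κ ι → Matrix ι ι ℝ) (z : Model κ ι) (v w : ι → ℝ) : ℝ :=
  inner₁ (g z)
      (fun l => ∑ k, ∑ i, ∑ j, curvature (christoffel g) z l k i j * v i * w j * w k) v /
    (inner₁ (g z) v v * inner₁ (g z) w w - inner₁ (g z) v w ^ 2)

/-- A foliated Hermitian structure `(J, g)` in the normal bundle of a foliation: a foliated
Riemannian metric `g` and a foliated field `J` of endomorphisms (components `J^a_b`) with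
`J² = -1` and `g(J·, J·) = g`. -/
structure FoliatedHermitianStructure {M A : Type*} [TopologicalSpace M]
    (𝒜 : FoliatedAtlas κ ι M A) where
  metric : FoliatedMetric 𝒜
  J : A → Model κ ι → Matrix ι ι ℝ
  J_smooth : ∀ e i j, ContDiffOn ℝ ∞ (fun z => J e z i j) (𝒜.chart e).target
  J_basic : ∀ e i j, IsBasicOn (fun z => J e z i j) (𝒜.chart e).target
  J_transform : ∀ e e', ∀ z ∈ (𝒜.transition e e').source,
    𝒜.jacobian e e' z * J e z = J e' (𝒜.transition e e' z) * 𝒜.jacobian e e' z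
  J_mul_J : ∀ e, ∀ z ∈ (𝒜.chart e).target, J e z * J e z = -1
  metric_J : ∀ e, ∀ z ∈ (𝒜.chart e).target,
    (J e z)ᵀ * metric.comp e z * J e z = metric.comp e z

/-- The holomorphic normal sectional curvature, i.e. the sectional curvature of the metric in the
normal bundle on the planes spanned by `w` and `J w`, `w ≠ 0`, is constant equal to `c`. -/
def FoliatedHermitianStructure.HasConstantHolomorphicCurvature {M A : Type*}
    [TopologicalSpace M] {𝒜 : FoliatedAtlas κ ι M A} (H : FoliatedHermitianStructure 𝒜)
    (c : ℝ) : Prop :=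
  ∀ e, ∀ z ∈ (𝒜.chart e).target, ∀ w : ι → ℝ, w ≠ 0 →
    sectionalCurvature (H.metric.comp e) z w (H.J e z *ᵥ w) = c

/-! ### Foliated Hessian structures -/

/-- An adapted chart is affine for the connection `D` if the frame `∂̄/∂y^i` is
`D`-parallel. -/
def FoliatedConnection.IsAffineChart {M A : Type*} [TopologicalSpace M]
    {𝒜 : FoliatedAtlas κ ι M A} (D : FoliatedConnection 𝒜) (e : A) : Prop :=
  ∀ z ∈ (𝒜.chart e).target, ∀ k i j, D.comp e z k i j = 0

end Foliated

variable {κ ι : Type*} [Fintype κ] [Fintype ι] [DecidableEq ι]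

variable (κ ι) in
/-- A foliated Hessian structure `(D, g)` on a foliated manifold `M`: a flat torsion-free foliated
connection `D` and a foliated Riemannian metric `g` in the normal bundle, such that `g` is locally
of the form `∑ ∂²h/∂y^i∂y^j dy^i dy^j` in adapted affine coordinates, with `h` basic. -/
structure FoliatedHessianStructure (M : Type*) [TopologicalSpace M]
    [ChartedSpace (Model κ ι) M] [HasGroupoid M (foliationGroupoid κ ι)] where
  D : FoliatedConnection (adaptedAtlas κ ι M)
  g : FoliatedMetric (adaptedAtlas κ ι M)
  torsion_free : ∀ e, ∀ z ∈ ((adaptedAtlas κ ι M).chart e).target, ∀ k i j,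
    D.comp e z k i j = D.comp e z k j i
  flat : ∀ e, ∀ z ∈ ((adaptedAtlas κ ι M).chart e).target, ∀ l k i j,
    curvature (D.comp e) z l k i j = 0
  hessian : ∀ x : M, ∃ e, D.IsAffineChart e ∧ x ∈ ((adaptedAtlas κ ι M).chart e).source ∧
    ∃ h : Model κ ι → ℝ, ContDiffOn ℝ ∞ h ((adaptedAtlas κ ι M).chart e).target ∧
      IsBasicOn h ((adaptedAtlas κ ι M).chart e).target ∧
      ∀ z ∈ ((adaptedAtlas κ ι M).chart e).target, ∀ i j,
        g.comp e z i j = tderiv i (tderiv j h) z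

namespace FoliatedHessianStructure

variable {M : Type*} [TopologicalSpace M] [ChartedSpace (Model κ ι) M]
  [HasGroupoid M (foliationGroupoid κ ι)] (S : FoliatedHessianStructure κ ι M)

/-- Adapted foliated affine coordinate systems. -/
def AffineChart : Type _ :=
  {e : (foliationGroupoid κ ι).maximalAtlas M // S.D.IsAffineChart e}

/-- The atlas of all adapted foliated affine coordinate systems. -/
def affineAtlas : FoliatedAtlas κ ι M S.AffineChart where
  chart e := (adaptedAtlas κ ι M).chart e.1
  exists_mem_source x := by
    obtain ⟨e, he, hx, -⟩ := S.hessian x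
    exact ⟨⟨e, he⟩, hx⟩
  compatible e e' := (adaptedAtlas κ ι M).compatible e.1 e'.1

/-! #### Hessian curvature -/

/-- The difference tensor `γ = ∇ - D`, where `∇` is the Levi-Civita connection of `g`: here
`S.gamma e z i j l` is `γ^i_jl`. -/
def gamma (e : (foliationGroupoid κ ι).maximalAtlas M) (z : Model κ ι) (i j l : ι) : ℝ :=
  christoffel (S.g.comp e) z i j l - S.D.comp e z i j l

/-- The normal Hessian curvature tensor `Q = Dγ`: here `S.hessianCurvature e z i j k l` is
`Q^i_{jkl} = (D_{∂/∂y^k} γ)^i_jl`, which in adapted affine coordinates is `∂γ^i_jl/∂y^k`. -/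
def hessianCurvature (e : (foliationGroupoid κ ι).maximalAtlas M) (z : Model κ ι)
    (i j k l : ι) : ℝ :=
  tderiv k (fun w => S.gamma e w i j l) z +
    ∑ m, (S.D.comp e z i k m * S.gamma e z m j l - S.D.comp e z m k j * S.gamma e z i m l -
      S.D.comp e z m k l * S.gamma e z i j m)

/-- The endomorphism `ξ ↦ Q̂(ξ)`, `Q̂(ξ)^{ik} = Q^i_j^k_l ξ^{jl}`, of contravariant normal
two-tensors. -/
def hessianCurvatureOp (e : (foliationGroupoid κ ι).maximalAtlas M) (z : Model κ ι)
    (ξ : Matrix ι ι ℝ) : Matrix ι ι ℝ :=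
  Matrix.of fun i k => ∑ j, ∑ l,
    (∑ m, (S.g.comp e z)⁻¹ k m * S.hessianCurvature e z i j m l) * ξ j l

end FoliatedHessianStructure

/-- The inner product of contravariant two-tensors induced by `g`. -/
def inner₂ (g : Matrix ι ι ℝ) (ξ η : Matrix ι ι ℝ) : ℝ :=
  ∑ i, ∑ k, ∑ a, ∑ b, g i a * g k b * ξ i k * η a b

namespace FoliatedHessianStructure

variable {M : Type*} [TopologicalSpace M] [ChartedSpace (Model κ ι) M]
  [HasGroupoid M (foliationGroupoid κ ι)] (S : FoliatedHessianStructure κ ι M)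

/-- The normal Hessian sectional curvature `q(ξ) = ⟨Q̂(ξ), ξ⟩ / ⟨ξ, ξ⟩`. -/
def hessianSectionalCurvature (e : (foliationGroupoid κ ι).maximalAtlas M) (z : Model κ ι)
    (ξ : Matrix ι ι ℝ) : ℝ :=
  inner₂ (S.g.comp e z) (S.hessianCurvatureOp e z ξ) ξ / inner₂ (S.g.comp e z) ξ ξ

/-- The normal Hessian sectional curvature, computed in adapted foliated affine coordinates, is
equal to the constant `c` on all nonzero symmetric contravariant normal two-tensors. -/
def HasConstantHessianSectionalCurvature (c : ℝ) : Prop :=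
  ∀ e : (foliationGroupoid κ ι).maximalAtlas M, S.D.IsAffineChart e →
    ∀ z ∈ ((adaptedAtlas κ ι M).chart e).target, ∀ ξ : Matrix ι ι ℝ, ξ.IsSymm → ξ ≠ 0 →
      S.hessianSectionalCurvature e z ξ = c

end FoliatedHessianStructure

/-! ### The normal bundle as a foliated manifold -/

variable (κ ι) in
/-- The identification `((x, y), v) ↦ (x, (y, v))`. -/
def reassoc : (Model κ ι × (ι → ℝ)) ≃L[ℝ] Model κ (ι ⊕ ι) where
  toFun w := (w.1.1, Sum.elim w.1.2 w.2)
  invFun z := ((z.1, fun i => z.2 (Sum.inl i)), fun i => z.2 (Sum.inr i))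
  map_add' v w := by
    ext i
    · rfl
    · cases i <;> rfl
  map_smul' c w := by
    ext i
    · rfl
    · cases i <;> rfl
  left_inv w := rfl
  right_inv z := by
    ext i
    · rfl
    · cases i <;> rfl
  continuous_toFun := by
    refine Continuous.prodMk (by fun_prop) (continuous_pi fun i => ?_)
    cases i
    · simp only [Sum.elim_inl]; fun_prop
    · simp only [Sum.elim_inr]; fun_prop
  continuous_invFun := by fun_prop

namespace FoliatedAtlas

variable {M : Type*} [TopologicalSpace M] {A : Type*} (𝒜 : FoliatedAtlas κ ι M A)

/-- The chart `(x, y, dy)` of the normal bundle induced by an adapted chart `(x, y)`. -/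
def liftChart (e : A) : OpenPartialHomeomorph 𝒜.NormalBundle (Model κ (ι ⊕ ι)) :=
  ((𝒜.normalBundleCore.localTriv e).toOpenPartialHomeomorph ≫ₕ
    (𝒜.chart e).prod (OpenPartialHomeomorph.refl (ι → ℝ))) ≫ₕ
    (reassoc κ ι).toHomeomorph.toOpenPartialHomeomorph


lemma mem_liftChart_target {e : A} {Z : Model κ (ι ⊕ ι)} :
    Z ∈ (𝒜.liftChart e).target ↔ ((reassoc κ ι).symm Z).1 ∈ (𝒜.chart e).target := by
  simp only [liftChart, mfld_simps]
  exact ⟨fun h => h.1, fun h => ⟨h, (𝒜.chart e).map_target h⟩⟩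

lemma mem_liftChart_transition_source {e e' : A} {Z : Model κ (ι ⊕ ι)} :
    Z ∈ ((𝒜.liftChart e).symm ≫ₕ 𝒜.liftChart e').source ↔
      ((reassoc κ ι).symm Z).1 ∈ (𝒜.transition e e').source := by
  rw [OpenPartialHomeomorph.trans_source, OpenPartialHomeomorph.symm_source, mem_inter_iff,
    mem_liftChart_target, mem_transition_source]
  refine and_congr_right fun h => ?_
  simp only [liftChart, mfld_simps]
  exact ⟨fun h => h.2, fun h => ⟨h, h⟩⟩

/-- The change of coordinates between two induced charts of the normal bundle is
`(x, (y, v)) ↦ (x', (y', ∂y'/∂y · v))`. -/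
lemma liftChart_transition {e e' : A} {Z : Model κ (ι ⊕ ι)}
    (hZ : ((reassoc κ ι).symm Z).1 ∈ (𝒜.transition e e').source) :
    𝒜.liftChart e' ((𝒜.liftChart e).symm Z) =
      reassoc κ ι (𝒜.transition e e' ((reassoc κ ι).symm Z).1,
        𝒜.normalDeriv e e' ((reassoc κ ι).symm Z).1 ((reassoc κ ι).symm Z).2) := by
  obtain ⟨h1, h2⟩ := 𝒜.mem_transition_source.1 hZ
  have h3 : 𝒜.liftChart e' ((𝒜.liftChart e).symm Z) =
      reassoc κ ι (𝒜.transition e e' ((reassoc κ ι).symm Z).1,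
        𝒜.normalBundleCore.coordChange
          (𝒜.normalBundleCore.indexAt ((𝒜.chart e).symm ((reassoc κ ι).symm Z).1)) e'
          ((𝒜.chart e).symm ((reassoc κ ι).symm Z).1)
          (𝒜.normalBundleCore.coordChange e
            (𝒜.normalBundleCore.indexAt ((𝒜.chart e).symm ((reassoc κ ι).symm Z).1))
            ((𝒜.chart e).symm ((reassoc κ ι).symm Z).1) ((reassoc κ ι).symm Z).2)) := rfl
  rw [h3, 𝒜.normalBundleCore.coordChange_comp _ _ _ _
    ⟨⟨(𝒜.chart e).map_target h1, 𝒜.normalBundleCore.mem_baseSet_at _⟩, h2⟩]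
  change reassoc κ ι (_, 𝒜.normalDeriv e e' (𝒜.chart e ((𝒜.chart e).symm _)) _) = _
  rw [(𝒜.chart e).right_inv h1]

lemma contDiffAt_normalDeriv (e e' : A) {z : Model κ ι}
    (hz : z ∈ (𝒜.transition e e').source) : ContDiffAt ℝ ∞ (𝒜.normalDeriv e e') z := by
  have h : ContDiffAt ℝ ∞ (fderiv ℝ (𝒜.transition e e')) z :=
    (𝒜.contDiffAt_transition e e' hz).fderiv_right (by simp)
  exact contDiffAt_const.clm_comp (h.clm_comp contDiffAt_const)

lemma fderiv_normalDeriv (e e' : A) {z : Model κ ι} (hz : z ∈ (𝒜.transition e e').source)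
    (b : Model κ ι) (v : ι → ℝ) :
    fderiv ℝ (𝒜.normalDeriv e e') z b v =
      (fderiv ℝ (fderiv ℝ (𝒜.transition e e')) z b (0, v)).2 := by
  have h : ContDiffAt ℝ ∞ (fderiv ℝ (𝒜.transition e e')) z :=
    (𝒜.contDiffAt_transition e e' hz).fderiv_right (by simp)
  have h1 := (h.differentiableAt (by simp)).hasFDerivAt
  have h2 := (hasFDerivAt_const (ContinuousLinearMap.snd ℝ (κ → ℝ) (ι → ℝ)) z).clm_comp
    (h1.clm_comp (hasFDerivAt_const (ContinuousLinearMap.inr ℝ (κ → ℝ) (ι → ℝ)) z))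
  have h3 : HasFDerivAt (𝒜.normalDeriv e e') _ z := h2
  rw [h3.fderiv]
  simp

lemma fderiv_normalDeriv_leaf (e e' : A) {z : Model κ ι}
    (hz : z ∈ (𝒜.transition e e').source) (a : κ → ℝ) (v : ι → ℝ) :
    fderiv ℝ (𝒜.normalDeriv e e') z (a, 0) v = 0 := by
  rw [fderiv_normalDeriv 𝒜 e e' hz]
  have hs : IsSymmSndFDerivAt ℝ (𝒜.transition e e') z :=
    (𝒜.contDiffAt_transition e e' hz).isSymmSndFDerivAt
      (by simpa using WithTop.coe_le_coe.2 (le_top : (2 : ℕ∞) ≤ ⊤))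
  rw [hs (a, 0) (0, v)]
  have h : ContDiffAt ℝ ∞ (fderiv ℝ (𝒜.transition e e')) z :=
    (𝒜.contDiffAt_transition e e' hz).fderiv_right (by simp)
  have h1 := (h.differentiableAt (by simp)).hasFDerivAt
  have h2 := (hasFDerivAt_const (ContinuousLinearMap.snd ℝ (κ → ℝ) (ι → ℝ)) z).clm_apply
    (h1.clm_apply (hasFDerivAt_const ((a, 0) : Model κ ι) z))
  have h4 : (fun w => ContinuousLinearMap.snd ℝ (κ → ℝ) (ι → ℝ)
      (fderiv ℝ (𝒜.transition e e') w (a, 0))) =ᶠ[𝓝 z] fun _ => 0 := by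
    filter_upwards [(𝒜.transition e e').open_source.mem_nhds hz] with w hw
    exact (𝒜.isFoliatedOn e e').2 w hw a
  have h5 := h2.fderiv
  rw [h4.fderiv_eq] at h5
  have h6 := congrArg (fun L => L (0, v)) h5
  simpa using h6.symm

/-- The change of coordinates between the charts of the normal bundle induced by `e` and `e'`. -/
def liftTransition (e e' : A) (Z : Model κ (ι ⊕ ι)) : Model κ (ι ⊕ ι) :=
  reassoc κ ι (𝒜.transition e e' ((reassoc κ ι).symm Z).1,
    𝒜.normalDeriv e e' ((reassoc κ ι).symm Z).1 ((reassoc κ ι).symm Z).2)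

lemma hasFDerivAt_liftTransition (e e' : A) {Z : Model κ (ι ⊕ ι)}
    (hZ : ((reassoc κ ι).symm Z).1 ∈ (𝒜.transition e e').source) :
    ∃ L : Model κ (ι ⊕ ι) →L[ℝ] Model κ (ι ⊕ ι), HasFDerivAt (𝒜.liftTransition e e') L Z ∧
      ∀ W, L W = reassoc κ ι
        (fderiv ℝ (𝒜.transition e e') ((reassoc κ ι).symm Z).1 ((reassoc κ ι).symm W).1,
          fderiv ℝ (𝒜.normalDeriv e e') ((reassoc κ ι).symm Z).1 ((reassoc κ ι).symm W).1
              ((reassoc κ ι).symm Z).2 +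
            𝒜.normalDeriv e e' ((reassoc κ ι).symm Z).1 ((reassoc κ ι).symm W).2) := by
  have hr := (reassoc κ ι).symm.hasFDerivAt (x := Z)
  have h1 := (𝒜.differentiableAt_transition e e' hZ).hasFDerivAt.comp Z hr.fst
  have h2 := ((𝒜.contDiffAt_normalDeriv e e' hZ).differentiableAt (by simp)).hasFDerivAt.comp Z
    hr.fst
  have h3 := (reassoc κ ι).hasFDerivAt.comp Z (h1.prodMk (h2.clm_apply hr.snd))
  refine ⟨_, h3, fun W => ?_⟩
  simp [add_comm]

lemma isFoliatedOn_lift (e e' : A) :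
    IsFoliatedOn ((𝒜.liftChart e).symm ≫ₕ 𝒜.liftChart e')
      ((𝒜.liftChart e).symm ≫ₕ 𝒜.liftChart e').source := by
  refine (foliationPregroupoid κ (ι ⊕ ι)).congr (f := 𝒜.liftTransition e e')
    (OpenPartialHomeomorph.open_source _) (fun Z hZ => ?_) ⟨fun Z hZ => ?_, fun Z hZ a => ?_⟩
  · exact 𝒜.liftChart_transition (𝒜.mem_liftChart_transition_source.1 hZ)
  · rw [mem_liftChart_transition_source] at hZ
    have hr : ContDiffAt ℝ ∞ (reassoc κ ι).symm Z := (reassoc κ ι).symm.contDiff.contDiffAt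
    have h1 := (𝒜.contDiffAt_transition e e' hZ).comp Z hr.fst
    have h2 := (𝒜.contDiffAt_normalDeriv e e' hZ).comp Z hr.fst
    exact ((reassoc κ ι).contDiff.contDiffAt.comp Z
      (h1.prodMk (h2.clm_apply hr.snd))).contDiffWithinAt
  · rw [mem_liftChart_transition_source] at hZ
    obtain ⟨L, hL, hL'⟩ := 𝒜.hasFDerivAt_liftTransition e e' hZ
    have h0 : (reassoc κ ι).symm (a, 0) = ((a, 0), 0) := rfl
    rw [hL.fderiv, hL', h0]
    simp only [map_zero, add_zero]
    rw [𝒜.fderiv_normalDeriv_leaf e e' hZ]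
    have h1 := (𝒜.isFoliatedOn e e').2 _ hZ a
    funext i
    cases i
    · exact congrFun h1 _
    · rfl

/-- The foliation `F_N` of the normal bundle `N(M, F)`, of dimension `#κ` and codimension `2 #ι`,
given by the atlas of all induced charts `(x, (y, dy))`. -/
def normalAtlas : FoliatedAtlas κ (ι ⊕ ι) 𝒜.NormalBundle A where
  chart := 𝒜.liftChart
  exists_mem_source u := by
    obtain ⟨e, he⟩ := 𝒜.exists_mem_source u.1
    refine ⟨e, ?_⟩
    simp only [liftChart, mfld_simps]
    exact ⟨he, he⟩
  compatible e e' :=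
    mem_groupoid_of_pregroupoid.2 ⟨𝒜.isFoliatedOn_lift e e', 𝒜.isFoliatedOn_lift e' e⟩

lemma fst_normalTransition {e e' : A} {Z : Model κ (ι ⊕ ι)}
    (hZ : Z ∈ (𝒜.normalAtlas.transition e e').source) :
    ((reassoc κ ι).symm (𝒜.normalAtlas.transition e e' Z)).1 =
      𝒜.transition e e' ((reassoc κ ι).symm Z).1 := by
  have h := 𝒜.liftChart_transition (𝒜.mem_liftChart_transition_source.1 hZ)
  change ((reassoc κ ι).symm (𝒜.liftChart e' ((𝒜.liftChart e).symm Z))).1 = _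
  rw [h]
  simp

lemma fderiv_normalTransition {e e' : A} {Z : Model κ (ι ⊕ ι)}
    (hZ : Z ∈ (𝒜.normalAtlas.transition e e').source) (W : Model κ (ι ⊕ ι)) :
    fderiv ℝ (𝒜.normalAtlas.transition e e') Z W = reassoc κ ι
        (fderiv ℝ (𝒜.transition e e') ((reassoc κ ι).symm Z).1 ((reassoc κ ι).symm W).1,
          fderiv ℝ (𝒜.normalDeriv e e') ((reassoc κ ι).symm Z).1 ((reassoc κ ι).symm W).1
              ((reassoc κ ι).symm Z).2 +
            𝒜.normalDeriv e e' ((reassoc κ ι).symm Z).1 ((reassoc κ ι).symm W).2) := by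
  obtain ⟨L, hL, hL'⟩ :=
    𝒜.hasFDerivAt_liftTransition e e' (𝒜.mem_liftChart_transition_source.1 hZ)
  have h : 𝒜.normalAtlas.transition e e' =ᶠ[𝓝 Z] 𝒜.liftTransition e e' := by
    filter_upwards [(𝒜.normalAtlas.transition e e').open_source.mem_nhds hZ] with Y hY
    exact 𝒜.liftChart_transition (𝒜.mem_liftChart_transition_source.1 hY)
  rw [h.fderiv_eq, hL.fderiv, hL']

lemma jacobian_apply {e e' : A} {z : Model κ ι} (hz : z ∈ (𝒜.transition e e').source) (a b : ι) :
    𝒜.jacobian e e' z a b = (fderiv ℝ (𝒜.transition e e') z (0, Pi.single b 1)).2 a := by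
  have h := (𝒜.differentiableAt_transition e e' hz).hasFDerivAt.snd
  have h2 := hasFDerivAt_pi'.1 h a
  simp only [jacobian, Matrix.of_apply, tderiv]
  rw [h2.fderiv]
  rfl

/-- If the transverse Jacobian matrix of a change of coordinates is constant along the transverse
directions, the transverse Jacobian matrix of the induced change of coordinates of the normal
bundle is block diagonal. -/
lemma jacobian_normalAtlas {e e' : A}
    (h : ∀ z ∈ (𝒜.transition e e').source, ∀ c i j,
      tderiv i (fun w => 𝒜.jacobian e e' w c j) z = 0)
    {Z : Model κ (ι ⊕ ι)} (hZ : Z ∈ (𝒜.normalAtlas.transition e e').source) :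
    𝒜.normalAtlas.jacobian e e' Z =
      Matrix.fromBlocks (𝒜.jacobian e e' ((reassoc κ ι).symm Z).1) 0 0
        (𝒜.jacobian e e' ((reassoc κ ι).symm Z).1) := by
  have hz := 𝒜.mem_liftChart_transition_source.1 hZ
  set z := ((reassoc κ ι).symm Z).1 with hzdef
  have hl : ∀ b : ι, (reassoc κ ι).symm (0, Pi.single (Sum.inl b) 1) =
      ((0, Pi.single b 1), 0) := by
    intro b
    refine Prod.ext (Prod.ext rfl (funext fun i => ?_)) (funext fun i => ?_)
    · change (Pi.single (Sum.inl b) 1 : ι ⊕ ι → ℝ) (Sum.inl i) = _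
      simp [Pi.single_apply]
    · change (Pi.single (Sum.inl b) 1 : ι ⊕ ι → ℝ) (Sum.inr i) = _
      simp
  have hr : ∀ b : ι, (reassoc κ ι).symm (0, Pi.single (Sum.inr b) 1) =
      (0, Pi.single b 1) := by
    intro b
    refine Prod.ext (Prod.ext rfl (funext fun i => ?_)) (funext fun i => ?_)
    · change (Pi.single (Sum.inr b) 1 : ι ⊕ ι → ℝ) (Sum.inl i) = _
      simp
    · change (Pi.single (Sum.inr b) 1 : ι ⊕ ι → ℝ) (Sum.inr i) = _
      simp [Pi.single_apply]
  have hsec : ∀ (b : ι) (v : ι → ℝ),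
      fderiv ℝ (𝒜.normalDeriv e e') z (0, Pi.single b 1) v = 0 := by
    intro b v
    rw [← ContinuousLinearMap.coe_coe,
      LinearMap.pi_apply_eq_sum_univ _ v]
    refine Finset.sum_eq_zero fun j _ => ?_
    have h0 : fderiv ℝ (𝒜.normalDeriv e e') z (0, Pi.single b 1) (Pi.single j 1) = 0 := by
      funext c
      have h1 := h z hz c b j
      have h2 : (fun w => 𝒜.jacobian e e' w c j) =ᶠ[𝓝 z]
          fun w => 𝒜.normalDeriv e e' w (Pi.single j 1) c := by
        filter_upwards [(𝒜.transition e e').open_source.mem_nhds hz] with w hw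
        rw [𝒜.jacobian_apply hw]
        rfl
      rw [tderiv, h2.fderiv_eq] at h1
      have h3 := ((𝒜.contDiffAt_normalDeriv e e' hz).differentiableAt
        (by simp)).hasFDerivAt.clm_apply (hasFDerivAt_const (Pi.single j (1 : ℝ)) z)
      have h4 := hasFDerivAt_pi'.1 h3 c
      rw [h4.fderiv] at h1
      simpa using h1
    have h5 : (fun i => if j = i then (1 : ℝ) else 0) = Pi.single j 1 := by
      funext i; simp [Pi.single_apply, eq_comm]
    rw [h5, ContinuousLinearMap.coe_coe, h0, smul_zero]
  ext a b
  rw [jacobian_apply _ hZ, fderiv_normalTransition _ hZ]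
  rcases b with b | b
  · rw [hl, hsec]
    rcases a with a | a
    · rw [Matrix.fromBlocks_apply₁₁, 𝒜.jacobian_apply hz]; rfl
    · rw [map_zero, add_zero]; rfl
  · rw [hr, map_zero, map_zero, zero_apply, zero_add]
    rcases a with a | a
    · rfl
    · rw [Matrix.fromBlocks_apply₂₂, 𝒜.jacobian_apply hz]; rfl

end FoliatedAtlas

lemma posDef_fromBlocks {g : Matrix ι ι ℝ} (hg : g.PosDef) :
    (Matrix.fromBlocks g 0 0 g).PosDef := by
  rw [Matrix.posDef_iff_dotProduct_mulVec] at hg ⊢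
  refine ⟨by rw [Matrix.IsHermitian, Matrix.fromBlocks_conjTranspose, hg.1.eq]; simp,
    fun x hx => ?_⟩
  have h : ∀ v : ι → ℝ, 0 ≤ star v ⬝ᵥ (g *ᵥ v) := fun v => by
    by_cases hv : v = 0
    · simp [hv]
    · exact (hg.2 hv).le
  obtain ⟨u, v, rfl⟩ : ∃ u v : ι → ℝ, x = Sum.elim u v :=
    ⟨x ∘ Sum.inl, x ∘ Sum.inr, (Sum.elim_comp_inl_inr x).symm⟩
  have he : star (Sum.elim u v) ⬝ᵥ (Matrix.fromBlocks g 0 0 g *ᵥ Sum.elim u v) =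
      star u ⬝ᵥ (g *ᵥ u) + star v ⬝ᵥ (g *ᵥ v) := by
    simp [Matrix.fromBlocks_mulVec, dotProduct, Fintype.sum_sum_type]
  rw [he]
  by_cases hu : u = 0
  · have hv : v ≠ 0 := by
      rintro rfl
      apply hx
      rw [hu]
      funext i; cases i <;> rfl
    exact add_pos_of_nonneg_of_pos (h u) (hg.2 hv)
  · exact add_pos_of_pos_of_nonneg (hg.2 hu) (h v)

lemma contDiffOn_lift {f : Model κ ι → ℝ} {s : Set (Model κ ι)} {t : Set (Model κ (ι ⊕ ι))}
    (hf : ContDiffOn ℝ ∞ f s) (h : ∀ Z ∈ t, ((reassoc κ ι).symm Z).1 ∈ s) :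
    ContDiffOn ℝ ∞ (fun Z => f ((reassoc κ ι).symm Z).1) t :=
  hf.comp (contDiff_fst.comp (reassoc κ ι).symm.contDiff).contDiffOn h

lemma isBasicOn_lift {f : Model κ ι → ℝ} {s : Set (Model κ ι)} {t : Set (Model κ (ι ⊕ ι))}
    (hs : IsOpen s) (hf : ContDiffOn ℝ ∞ f s) (hb : IsBasicOn f s)
    (h : ∀ Z ∈ t, ((reassoc κ ι).symm Z).1 ∈ s) :
    IsBasicOn (fun Z => f ((reassoc κ ι).symm Z).1) t := by
  intro Z hZ a
  have h1 := ((hf.contDiffAt (hs.mem_nhds (h Z hZ))).differentiableAt (by simp)).hasFDerivAt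
  have h2 : HasFDerivAt (fun Z => f ((reassoc κ ι).symm Z).1) _ Z :=
    h1.comp Z ((reassoc κ ι).symm.hasFDerivAt (x := Z)).fst
  rw [h2.fderiv]
  exact hb _ (h Z hZ) a

namespace FoliatedHessianStructure

variable {M : Type*} [TopologicalSpace M] [ChartedSpace (Model κ ι) M]
  [HasGroupoid M (foliationGroupoid κ ι)] (S : FoliatedHessianStructure κ ι M)

lemma jacobian_normalAtlas (e e' : S.AffineChart) {Z : Model κ (ι ⊕ ι)}
    (hZ : Z ∈ (S.affineAtlas.normalAtlas.transition e e').source) :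
    S.affineAtlas.normalAtlas.jacobian e e' Z =
      Matrix.fromBlocks (S.affineAtlas.jacobian e e' ((reassoc κ ι).symm Z).1) 0 0
        (S.affineAtlas.jacobian e e' ((reassoc κ ι).symm Z).1) := by
  refine S.affineAtlas.jacobian_normalAtlas (fun z hz c i j => ?_) hZ
  have h := S.D.transform e.1 e'.1 z hz c i j
  have h1 : ∀ k i j, S.D.comp e.1 z k i j = 0 :=
    e.2 z ((S.affineAtlas.mem_transition_source (i := e) (j := e')).1 hz).1
  have h2 : ∀ k i j, S.D.comp e'.1 ((adaptedAtlas κ ι M).transition e.1 e'.1 z) k i j = 0 :=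
    e'.2 _ (((adaptedAtlas κ ι M).chart e'.1).map_source
      ((S.affineAtlas.mem_transition_source (i := e) (j := e')).1 hz).2)
  simp only [h1, h2, zero_mul, mul_zero, Finset.sum_const_zero, add_zero] at h
  exact h.symm

/-- The metric `g^N` in the normal bundle of `(N(M, F), F_N)`: in the chart `(x, (y, v))`, `v = dy`,
induced by an adapted affine chart `(x, y)`, it is
`∑ g_ij(y) dz^i dz̄^j = ∑ g_ij(y) (dy^i dy^j + dv^i dv^j)`, with `z = y + √-1 v`. -/
def normalMetric : FoliatedMetric S.affineAtlas.normalAtlas where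
  comp e Z := Matrix.fromBlocks (S.g.comp e.1 ((reassoc κ ι).symm Z).1) 0 0
    (S.g.comp e.1 ((reassoc κ ι).symm Z).1)
  smooth e i j := by
    rcases i with i | i <;> rcases j with j | j
    · exact contDiffOn_lift (S.g.smooth e.1 i j)
        fun Z hZ => S.affineAtlas.mem_liftChart_target.1 hZ
    · exact contDiffOn_const
    · exact contDiffOn_const
    · exact contDiffOn_lift (S.g.smooth e.1 i j)
        fun Z hZ => S.affineAtlas.mem_liftChart_target.1 hZ
  basic e i j := by
    rcases i with i | i <;> rcases j with j | j
    · exact isBasicOn_lift (OpenPartialHomeomorph.open_target _) (S.g.smooth e.1 i j)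
        (S.g.basic e.1 i j) fun Z hZ => S.affineAtlas.mem_liftChart_target.1 hZ
    · intro Z _ a; simp
    · intro Z _ a; simp
    · exact isBasicOn_lift (OpenPartialHomeomorph.open_target _) (S.g.smooth e.1 i j)
        (S.g.basic e.1 i j) fun Z hZ => S.affineAtlas.mem_liftChart_target.1 hZ
  posDef e Z hZ :=
    posDef_fromBlocks (S.g.posDef e.1 _ (S.affineAtlas.mem_liftChart_target.1 hZ))
  transform e e' Z hZ := by
    rw [S.jacobian_normalAtlas e e' hZ, S.affineAtlas.fst_normalTransition hZ,
      S.g.transform e.1 e'.1 _ (S.affineAtlas.mem_liftChart_transition_source.1 hZ)]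
    simp only [Matrix.fromBlocks_transpose, Matrix.fromBlocks_multiply, Matrix.transpose_zero,
      Matrix.zero_mul, Matrix.mul_zero, add_zero, zero_add]
    rfl

/-- The structure `(J^N, g^N)` on `(N(M, F), F_N)` induced by `(D, g)`: in the chart `(x, (y, v))`
induced by an adapted affine chart, `J^N` is the complex structure of the transverse holomorphic
coordinates `z = y + √-1 v`, that is `J^N ∂/∂y^i = ∂/∂v^i` and `J^N ∂/∂v^i = -∂/∂y^i`. -/
def normalKahlerStructure : FoliatedHermitianStructure S.affineAtlas.normalAtlas where
  metric := S.normalMetric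
  J _ _ := Matrix.fromBlocks 0 (-1) 1 0
  J_smooth _ _ _ := contDiffOn_const
  J_basic _ _ _ Z _ a := by simp
  J_transform e e' Z hZ := by
    rw [S.jacobian_normalAtlas e e' hZ]
    simp [Matrix.fromBlocks_multiply]
  J_mul_J _ _ _ := by
    rw [Matrix.fromBlocks_multiply, ← Matrix.fromBlocks_one, Matrix.fromBlocks_neg]
    simp
  metric_J e Z _ := by
    simp [normalMetric, Matrix.fromBlocks_transpose, Matrix.fromBlocks_multiply]

end FoliatedHessianStructure

end TransverseHessian

namespace TransverseHessian

/-! ### Calculus of transverse derivatives -/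

section TransverseCalculus

variable {κ ι : Type*} [Fintype κ] [Fintype ι] [DecidableEq ι]

/-! In an affine chart write `γ` for the Christoffel symbols of `g` and `T_lijk = g_lm ∂_i γ^m_jk`.
Since `∂_k g_ij` is totally symmetric, `γ_lij = ½ ∂_l g_ij`, and differentiating gives `T_lijk = ½
∂_i∂_j g_lk - 2 g_mn γ^n_li γ^m_jk` (`IsHessianOn.lowered_eq`). The first term is totally symmetric
and the second has the symmetries of a quadratic form on symmetric two-tensors, so `T` is symmetric
in `l, i` and under exchange of `(l, i)` with `(j, k)`. The numerator of the Hessian sectional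
curvature is exactly `T(ξ, ξ)` (`inner₂_hessianCurvatureOp`).

The coefficients of the lifted metric do not depend on the fibre coordinates, and its Christoffel
symbols are `±γ` or `0`. The terms quadratic in `γ` in its curvature can be traded for `T` by
`IsHessianOn.lowered_sub_lowered`, so the curvature becomes linear in `T`
(`lowered_curvature_liftMetric`). On the plane spanned by `w = a + √-1 b` and `Jw`, the holomorphic
curvature is `-T(w⊗w, w̄⊗w̄) / |w|⁴` (`sectionalCurvature_liftMetric`).

Let `G` be the tensor with `G(ξ, ξ) = |ξ|²` on symmetric `ξ`; then `G(w⊗w, w̄⊗w̄) = |w|⁴`. With `E =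
T - cG`, the two curvature conditions say that `E(ξ, ξ) = 0` for all symmetric real `ξ`,
respectively that `E(w⊗w, w̄⊗w̄) = 0` for all complex `w`. These are equivalent by polarization
(`IsHessianTensor.contract_eq_zero_iff`).

A potential is given only in some affine chart around each point. Changes of affine charts have
locally constant transverse Jacobian, so the symmetry of `∂g` holds in all affine charts
(`FoliatedHessianStructure.isHessianOn`). -/

lemma tderiv_congr {f f' : Model κ ι → ℝ} {z : Model κ ι} (h : f =ᶠ[𝓝 z] f') (i : ι) :
    tderiv i f z = tderiv i f' z := by
  rw [tderiv, tderiv, h.fderiv_eq]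

lemma tderiv_const (i : ι) (a : ℝ) (z : Model κ ι) : tderiv i (fun _ => a) z = 0 := by
  simp [tderiv]

lemma tderiv_neg (i : ι) (f : Model κ ι → ℝ) (z : Model κ ι) :
    tderiv i (fun w => -f w) z = -tderiv i f z := by
  simp [tderiv]

lemma tderiv_mul {f f' : Model κ ι → ℝ} {z : Model κ ι} (hf : DifferentiableAt ℝ f z)
    (hf' : DifferentiableAt ℝ f' z) (i : ι) :
    tderiv i (fun w => f w * f' w) z = tderiv i f z * f' z + f z * tderiv i f' z := by
  simp only [tderiv]
  rw [fderiv_fun_mul hf hf']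
  simp
  ring

lemma tderiv_sum {σ : Type*} {s : Finset σ} {f : σ → Model κ ι → ℝ} {z : Model κ ι}
    (hf : ∀ a ∈ s, DifferentiableAt ℝ (f a) z) (i : ι) :
    tderiv i (fun w => ∑ a ∈ s, f a w) z = ∑ a ∈ s, tderiv i (f a) z := by
  simp only [tderiv]
  rw [fderiv_fun_sum hf]
  simp

lemma contDiffAt_tderiv {f : Model κ ι → ℝ} {z : Model κ ι} (hf : ContDiffAt ℝ ∞ f z) (i : ι) :
    ContDiffAt ℝ ∞ (tderiv i f) z :=
  (hf.fderiv_right (by simp)).clm_apply contDiffAt_const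

lemma tderiv_comm {f : Model κ ι → ℝ} {z : Model κ ι} (hf : ContDiffAt ℝ ∞ f z) (i j : ι) :
    tderiv i (tderiv j f) z = tderiv j (tderiv i f) z := by
  have hs : IsSymmSndFDerivAt ℝ f z :=
    hf.isSymmSndFDerivAt (by simpa using WithTop.coe_le_coe.2 (le_top : (2 : ℕ∞) ≤ ⊤))
  have h : DifferentiableAt ℝ (fderiv ℝ f) z :=
    ((hf.fderiv_right (by simp)).differentiableAt (by simp : (∞ : WithTop ℕ∞) ≠ 0))
  have key : ∀ i j : ι, tderiv i (tderiv j f) z =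
      fderiv ℝ (fderiv ℝ f) z (0, Pi.single i 1) (0, Pi.single j 1) := by
    intro i j
    have h1 := h.hasFDerivAt.clm_apply
      (hasFDerivAt_const ((0, Pi.single j 1) : Model κ ι) z)
    change fderiv ℝ (fun w => fderiv ℝ f w (0, Pi.single j 1)) z _ = _
    rw [h1.fderiv]
    simp
  rw [key, key, hs]

lemma contDiffAt_det {g : Model κ ι → Matrix ι ι ℝ} {z : Model κ ι}
    (hg : ∀ i j, ContDiffAt ℝ ∞ (fun w => g w i j) z) : ContDiffAt ℝ ∞ (fun w => (g w).det) z := by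
  simp only [Matrix.det_apply']
  exact ContDiffAt.sum fun σ _ => contDiffAt_const.mul (contDiffAt_prod fun i _ => hg _ _)

lemma contDiffAt_inv {g : Model κ ι → Matrix ι ι ℝ} {z : Model κ ι}
    (hg : ∀ i j, ContDiffAt ℝ ∞ (fun w => g w i j) z) (hz : (g z).det ≠ 0) (i j : ι) :
    ContDiffAt ℝ ∞ (fun w => (g w)⁻¹ i j) z := by
  simp only [Matrix.inv_def, Ring.inverse_eq_inv', Matrix.smul_apply, Matrix.adjugate_apply,
    smul_eq_mul]
  refine ((contDiffAt_det hg).inv hz).mul (contDiffAt_det fun a b => ?_)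
  -- The adjugate entry is the determinant of `g` with row `j` replaced by a constant basis vector.
  by_cases h : a = j
  · subst h
    simpa using contDiffAt_const
  · simpa [Matrix.updateRow_ne h] using hg a b

end TransverseCalculus

/-! ### Hessian metrics on open subsets of the model -/

/-- A Riemannian metric `∑ g_ij dy^i dy^j` whose derivatives `∂g_ij/∂y^k` are totally symmetric. -/
structure IsHessianOn {κ ι : Type*} [Fintype κ] [Fintype ι] [DecidableEq ι]
    (g : Model κ ι → Matrix ι ι ℝ) (U : Set (Model κ ι)) : Prop where
  isOpen : IsOpen U
  smooth : ∀ i j, ContDiffOn ℝ ∞ (fun z => g z i j) U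
  posDef : ∀ z ∈ U, (g z).PosDef
  tderiv_swap : ∀ z ∈ U, ∀ i j k, tderiv k (fun w => g w i j) z = tderiv i (fun w => g w k j) z

/-- The lowered Hessian curvature `T_{lijk} = ∑_m g_lm ∂γ^m_jk/∂y^i` of a Hessian metric, where `γ`
are its Christoffel symbols. -/
def loweredHessianCurvature {κ ι : Type*} [Fintype κ] [Fintype ι] [DecidableEq ι]
    (g : Model κ ι → Matrix ι ι ℝ) (z : Model κ ι) (l i j k : ι) : ℝ :=
  ∑ m, g z l m * tderiv i (fun w => christoffel g w m j k) z

namespace IsHessianOn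

variable {κ ι : Type*} [Fintype κ] [Fintype ι] [DecidableEq ι] {g : Model κ ι → Matrix ι ι ℝ}
  {U : Set (Model κ ι)} {z : Model κ ι}

lemma contDiffAt (hg : IsHessianOn g U) (hz : z ∈ U) (i j : ι) :
    ContDiffAt ℝ ∞ (fun w => g w i j) z :=
  (hg.smooth i j).contDiffAt (hg.isOpen.mem_nhds hz)

lemma isUnit_det (hg : IsHessianOn g U) (hz : z ∈ U) : IsUnit (g z).det :=
  (hg.posDef z hz).det_pos.ne'.isUnit

lemma symm (hg : IsHessianOn g U) (hz : z ∈ U) (i j : ι) : g z i j = g z j i := by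
  simpa using (hg.posDef z hz).isHermitian.apply j i

lemma tderiv_symm (hg : IsHessianOn g U) (hz : z ∈ U) (i j k : ι) :
    tderiv k (fun w => g w i j) z = tderiv k (fun w => g w j i) z := by
  refine tderiv_congr ?_ k
  filter_upwards [hg.isOpen.mem_nhds hz] with w hw
  exact hg.symm hw i j

/-- The three derivatives in the Koszul formula coincide by total symmetry, and two of them cancel.
-/
lemma christoffel_eq (hg : IsHessianOn g U) (hz : z ∈ U) (k i j : ι) :
    christoffel g z k i j =
      (1 / 2) * ∑ l, (g z)⁻¹ k l * tderiv j (fun w => g w l i) z := by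
  rw [christoffel]
  congr 1
  refine Finset.sum_congr rfl fun l _ => ?_
  rw [hg.tderiv_swap z hz i j l, hg.tderiv_symm hz l j i, hg.tderiv_swap z hz j l i]
  ring

lemma christoffel_symm (hg : IsHessianOn g U) (hz : z ∈ U) (k i j : ι) :
    christoffel g z k i j = christoffel g z k j i := by
  rw [hg.christoffel_eq hz, hg.christoffel_eq hz]
  congr 1
  refine Finset.sum_congr rfl fun l _ => ?_
  rw [hg.tderiv_symm hz l i j, hg.tderiv_swap z hz i l j, hg.tderiv_symm hz j l i]

lemma contDiffAt_christoffel (hg : IsHessianOn g U) (hz : z ∈ U) (k i j : ι) :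
    ContDiffAt ℝ ∞ (fun w => christoffel g w k i j) z := by
  unfold christoffel
  refine contDiffAt_const.mul (ContDiffAt.sum fun l _ => ?_)
  refine (contDiffAt_inv (hg.contDiffAt hz) (hg.isUnit_det hz).ne_zero k l).mul ?_
  exact ((contDiffAt_tderiv (hg.contDiffAt hz _ _) _).add
    (contDiffAt_tderiv (hg.contDiffAt hz _ _) _)).sub (contDiffAt_tderiv (hg.contDiffAt hz _ _) _)

/-- This inverts `christoffel_eq` by multiplying with `g`; it eliminates first derivatives of the
metric in favour of `γ`. -/
lemma tderiv_eq (hg : IsHessianOn g U) (hz : z ∈ U) (l i j : ι) :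
    tderiv i (fun w => g w l j) z = 2 * ∑ m, g z l m * christoffel g z m i j := by
  have h : ∀ f : ι → ℝ, g z *ᵥ ((g z)⁻¹ *ᵥ f) = f := fun f => by
    rw [Matrix.mulVec_mulVec, Matrix.mul_nonsing_inv _ (hg.isUnit_det hz), Matrix.one_mulVec]
  have h1 := congrFun (h fun l => tderiv i (fun w => g w l j) z) l
  simp only [Matrix.mulVec, dotProduct] at h1
  rw [← h1, Finset.mul_sum]
  refine Finset.sum_congr rfl fun m _ => ?_
  rw [hg.christoffel_symm hz, hg.christoffel_eq hz]
  ring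

/-- Differentiate `∂_j g_lk = 2 g_lm γ^m_jk` in direction `i`: the derivative falling on `γ` is
`2T`, and the one falling on `g` is again expressed through `γ`. -/
lemma lowered_eq (hg : IsHessianOn g U) (hz : z ∈ U) (l i j k : ι) :
    loweredHessianCurvature g z l i j k =
      (1 / 2) * tderiv i (tderiv j fun w => g w l k) z -
        2 * ∑ m, ∑ n, g z m n * christoffel g z n l i * christoffel g z m j k := by
  have h : tderiv i (tderiv j fun w => g w l k) z =
      tderiv i (fun w => ∑ m, (2 * g w l m) * christoffel g w m j k) z := by
    refine tderiv_congr ?_ i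
    filter_upwards [hg.isOpen.mem_nhds hz] with w hw
    rw [hg.tderiv_eq hw, Finset.mul_sum]
    exact Finset.sum_congr rfl fun m _ => by ring
  have hd := fun a b => (hg.contDiffAt hz a b).differentiableAt (by simp)
  have hc := fun a b c => (hg.contDiffAt_christoffel hz a b c).differentiableAt (by simp)
  rw [h, tderiv_sum (f := fun m w => (2 * g w l m) * christoffel g w m j k)
    fun m _ => ((hd _ _).const_mul 2).mul (hc _ _ _)]
  rw [loweredHessianCurvature, Finset.mul_sum, Finset.mul_sum, ← Finset.sum_sub_distrib]
  refine Finset.sum_congr rfl fun m _ => ?_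
  rw [tderiv_mul ((hd _ _).const_mul 2) (hc _ _ _),
    tderiv_mul (differentiableAt_const _) (hd _ _), tderiv_const, hg.tderiv_symm hz,
    hg.tderiv_eq hz, ← Finset.sum_mul]
  simp only [hg.christoffel_symm hz _ l i]
  ring

/-- Together with the next two lemmas, this provides transpositions generating all permutations of
the four indices of `∂_i∂_j g_lk`, which would be fourth derivatives of a potential. -/
lemma sndDeriv_swap (hg : IsHessianOn g U) (hz : z ∈ U) (l i j k : ι) :
    tderiv i (tderiv j fun w => g w l k) z = tderiv i (tderiv l fun w => g w j k) z := by
  refine tderiv_congr ?_ i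
  filter_upwards [hg.isOpen.mem_nhds hz] with w hw
  exact hg.tderiv_swap w hw _ _ _

lemma sndDeriv_symm (hg : IsHessianOn g U) (hz : z ∈ U) (l i j k : ι) :
    tderiv i (tderiv j fun w => g w l k) z = tderiv i (tderiv j fun w => g w k l) z := by
  refine tderiv_congr ?_ i
  filter_upwards [hg.isOpen.mem_nhds hz] with w hw
  exact hg.tderiv_symm hw _ _ _

lemma sndDeriv_comm (hg : IsHessianOn g U) (hz : z ∈ U) (l i j k : ι) :
    tderiv i (tderiv j fun w => g w l k) z = tderiv j (tderiv i fun w => g w l k) z :=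
  tderiv_comm (hg.contDiffAt hz _ _) _ _

lemma lowered_comm_right (hg : IsHessianOn g U) (hz : z ∈ U) (l i j k : ι) :
    loweredHessianCurvature g z l i j k = loweredHessianCurvature g z l i k j := by
  refine Finset.sum_congr rfl fun m _ => ?_
  congr 1
  refine tderiv_congr ?_ i
  filter_upwards [hg.isOpen.mem_nhds hz] with w hw
  exact hg.christoffel_symm hw _ _ _

/-- In `lowered_eq` the second derivative of `g` is totally symmetric, and the quadratic term is the
`g`-product of `γ_li` and `γ_jk`. -/
lemma lowered_swap (hg : IsHessianOn g U) (hz : z ∈ U) (l i j k : ι) :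
    loweredHessianCurvature g z l i j k = loweredHessianCurvature g z j k l i := by
  rw [hg.lowered_eq hz, hg.lowered_eq hz]
  congr 1
  · rw [hg.sndDeriv_symm hz l i j k, hg.sndDeriv_swap hz k i j l, hg.sndDeriv_comm hz,
      hg.sndDeriv_comm hz j k l i, hg.sndDeriv_swap hz j l k i, hg.sndDeriv_comm hz k l j i,
      hg.sndDeriv_symm hz k j l i, hg.sndDeriv_swap hz i j l k,
      hg.sndDeriv_comm hz l j i k, hg.sndDeriv_comm hz j k i l, hg.sndDeriv_swap hz j i k l,
      hg.sndDeriv_symm hz k i j l,hg.sndDeriv_swap hz l i j k, hg.sndDeriv_comm hz]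
  · congr 1
    rw [Finset.sum_comm]
    refine Finset.sum_congr rfl fun m _ => Finset.sum_congr rfl fun n _ => ?_
    rw [hg.symm hz]
    ring

lemma lowered_comm_left (hg : IsHessianOn g U) (hz : z ∈ U) (l i j k : ι) :
    loweredHessianCurvature g z l i j k = loweredHessianCurvature g z i l j k := by
  rw [hg.lowered_swap hz, hg.lowered_comm_right hz, hg.lowered_swap hz]

/-- The curvature identity of a Hessian metric, with the upper index lowered. -/
lemma lowered_sub_lowered (hg : IsHessianOn g U) (hz : z ∈ U) (l k i j : ι) :
    ∑ n, g z l n * ∑ m, (christoffel g z n i m * christoffel g z m j k -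
        christoffel g z n j m * christoffel g z m i k) =
      -(1 / 2) * (loweredHessianCurvature g z l i j k - loweredHessianCurvature g z l j i k) := by
  have key : ∀ i j : ι, 2 * ∑ n, g z l n * ∑ m, christoffel g z n i m * christoffel g z m j k =
      (1 / 2) * tderiv i (tderiv j fun w => g w l k) z - loweredHessianCurvature g z l i j k := by
    intro i j
    rw [hg.lowered_eq hz, sub_sub_cancel]
    congr 1
    -- Both sides are values of the lowered symbol `γ_lim`, half of a totally symmetric derivative
    -- of `g`.
    have : ∀ m, ∑ n, g z l n * christoffel g z n i m = ∑ n, g z m n * christoffel g z n l i := by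
      intro m
      have h1 := hg.tderiv_eq hz l i m
      have h2 := hg.tderiv_eq hz m l i
      rw [hg.tderiv_swap z hz, hg.tderiv_symm hz] at h1
      linarith
    simp only [Finset.mul_sum]
    rw [Finset.sum_comm]
    refine Finset.sum_congr rfl fun m _ => ?_
    simp only [← mul_assoc]
    rw [← Finset.sum_mul, this, Finset.sum_mul]
  have h1 := key i j
  have h2 := key j i
  -- After this the second derivatives of `g` in the two instances of `key` agree and cancel on
  -- subtraction.
  rw [hg.sndDeriv_comm hz] at h1
  simp only [Finset.sum_sub_distrib, mul_sub]
  linarith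

end IsHessianOn

end TransverseHessian

namespace TransverseHessian

/-! ### Curvature of the lifted metric -/

section Lift

variable {κ ι : Type*} [Fintype κ] [Fintype ι] [DecidableEq ι]

/-- The projection `(x, (y, v)) ↦ (x, y)`. -/
def basePoint (Z : Model κ (ι ⊕ ι)) : Model κ ι := ((reassoc κ ι).symm Z).1

/-- The metric `∑ g_ij(y) (dy^i dy^j + dv^i dv^j)`. -/
def liftMetric (g : Model κ ι → Matrix ι ι ℝ) (Z : Model κ (ι ⊕ ι)) : Matrix (ι ⊕ ι) (ι ⊕ ι) ℝ :=
  Matrix.fromBlocks (g (basePoint Z)) 0 0 (g (basePoint Z))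

lemma continuous_basePoint : Continuous (basePoint : Model κ (ι ⊕ ι) → Model κ ι) :=
  continuous_fst.comp (reassoc κ ι).symm.continuous

lemma fderiv_comp_basePoint {f : Model κ ι → ℝ} {Z : Model κ (ι ⊕ ι)}
    (hf : DifferentiableAt ℝ f (basePoint Z)) (W : Model κ (ι ⊕ ι)) :
    fderiv ℝ (fun Y => f (basePoint Y)) Z W = fderiv ℝ f (basePoint Z) (basePoint W) := by
  have h : HasFDerivAt (fun Y => f (basePoint Y)) _ Z :=
    hf.hasFDerivAt.comp Z ((reassoc κ ι).symm.hasFDerivAt (x := Z)).fst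
  rw [h.fderiv]
  rfl

lemma tderiv_inl {f : Model κ ι → ℝ} {Z : Model κ (ι ⊕ ι)}
    (hf : DifferentiableAt ℝ f (basePoint Z)) (i : ι) :
    tderiv (Sum.inl i) (fun Y => f (basePoint Y)) Z = tderiv i f (basePoint Z) := by
  rw [tderiv, fderiv_comp_basePoint hf, tderiv]
  congr 1
  refine Prod.ext rfl (funext fun j => ?_)
  change (Pi.single (Sum.inl i) 1 : ι ⊕ ι → ℝ) (Sum.inl j) = _
  simp [Pi.single_apply]

lemma tderiv_inr {f : Model κ ι → ℝ} {Z : Model κ (ι ⊕ ι)}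
    (hf : DifferentiableAt ℝ f (basePoint Z)) (i : ι) :
    tderiv (Sum.inr i) (fun Y => f (basePoint Y)) Z = 0 := by
  rw [tderiv, fderiv_comp_basePoint hf]
  have h : basePoint ((0, Pi.single (Sum.inr i) 1) : Model κ (ι ⊕ ι)) = 0 := by
    refine Prod.ext rfl (funext fun j => ?_)
    change (Pi.single (Sum.inr i) 1 : ι ⊕ ι → ℝ) (Sum.inl j) = _
    simp
  rw [h, map_zero]

/-- The Christoffel symbols of the lift of a Hessian metric. -/
def liftChristoffel (g : Model κ ι → Matrix ι ι ℝ) (z : Model κ ι) :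
    ι ⊕ ι → ι ⊕ ι → ι ⊕ ι → ℝ
  | .inl k, .inl i, .inl j => christoffel g z k i j
  | .inl k, .inr i, .inr j => -christoffel g z k i j
  | .inr k, .inl i, .inr j => christoffel g z k i j
  | .inr k, .inr i, .inl j => christoffel g z k i j
  | _, _, _ => 0

namespace IsHessianOn

variable {g : Model κ ι → Matrix ι ι ℝ} {U : Set (Model κ ι)} {Z : Model κ (ι ⊕ ι)}

lemma inv_liftMetric (hg : IsHessianOn g U) (hZ : basePoint Z ∈ U) :
    (liftMetric g Z)⁻¹ = Matrix.fromBlocks (g (basePoint Z))⁻¹ 0 0 (g (basePoint Z))⁻¹ := by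
  refine Matrix.inv_eq_right_inv ?_
  rw [liftMetric, Matrix.fromBlocks_multiply]
  simp [Matrix.mul_nonsing_inv _ (hg.isUnit_det hZ)]

/-- Derivatives along the fibre vanish and the metric is block diagonal, so only symbols with an
even number of fibre indices survive. Two lower fibre indices leave only the term `-∂_l g_ij`,
whence the minus sign; in the mixed cases a single positive term remains. Total symmetry of `∂g`
identifies each of them with `±γ`. -/
lemma christoffel_liftMetric (hg : IsHessianOn g U) (hZ : basePoint Z ∈ U) (k i j : ι ⊕ ι) :
    christoffel (liftMetric g) Z k i j = liftChristoffel g (basePoint Z) k i j := by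
  have hd := fun a b => (hg.contDiffAt hZ a b).differentiableAt (by simp)
  have h1 : ∀ a b c, tderiv (Sum.inl c) (fun W => g (basePoint W) a b) Z =
      tderiv c (fun w => g w a b) (basePoint Z) := fun a b c => tderiv_inl (hd a b) c
  have h2 : ∀ a b c, tderiv (Sum.inr c) (fun W => g (basePoint W) a b) Z = 0 :=
    fun a b c => tderiv_inr (hd a b) c
  have hl : ∀ a b c : ι, tderiv c (fun w => g w a b) (basePoint Z) =
      tderiv a (fun w => g w c b) (basePoint Z) := hg.tderiv_swap _ hZ
  rw [christoffel, hg.inv_liftMetric hZ, Fintype.sum_sum_type]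
  simp only [liftMetric]
  rcases k with k | k <;> rcases i with i | i <;> rcases j with j | j <;>
    simp only [Matrix.fromBlocks_apply₁₁, Matrix.fromBlocks_apply₁₂, Matrix.fromBlocks_apply₂₁,
      Matrix.fromBlocks_apply₂₂, Matrix.zero_apply, zero_mul, Finset.sum_const_zero, add_zero,
      zero_add, h1, h2, tderiv_const, sub_self, mul_zero, liftChristoffel, sub_zero, zero_sub,
      mul_neg, Finset.sum_neg_distrib, neg_inj, neg_zero]
  · rfl
  · rw [hg.christoffel_eq hZ]
    congr! 3 with l
    rw [hl i j l, hg.tderiv_symm hZ l j, hl j l i, hg.tderiv_symm hZ i l]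
  · rw [hg.christoffel_symm hZ, hg.christoffel_eq hZ]
  · rw [hg.christoffel_eq hZ]

/-- The curvature of the lift of a Hessian metric in terms of its Christoffel symbols. -/
lemma curvature_liftMetric (hg : IsHessianOn g U) (hZ : basePoint Z ∈ U) (l k i j : ι ⊕ ι) :
    curvature (christoffel (liftMetric g)) Z l k i j =
      tderiv i (fun Y => liftChristoffel g (basePoint Y) l j k) Z -
        tderiv j (fun Y => liftChristoffel g (basePoint Y) l i k) Z +
      ∑ m, (liftChristoffel g (basePoint Z) l i m * liftChristoffel g (basePoint Z) m j k -
        liftChristoffel g (basePoint Z) l j m * liftChristoffel g (basePoint Z) m i k) := by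
  -- The formula for the symbols has to hold on a neighbourhood, since they are differentiated.
  have h : ∀ a b c, (fun Y => christoffel (liftMetric g) Y a b c) =ᶠ[𝓝 Z]
      fun Y => liftChristoffel g (basePoint Y) a b c := fun a b c =>
    Filter.eventually_of_mem ((hg.isOpen.preimage continuous_basePoint).mem_nhds hZ)
      fun Y hY => hg.christoffel_liftMetric hY a b c
  rw [curvature, tderiv_congr (h _ _ _), tderiv_congr (h _ _ _)]
  simp only [hg.christoffel_liftMetric hZ]

end IsHessianOn

/-- The curvature of the lift of a Hessian metric, with the upper index lowered, in terms of the
lowered Hessian curvature. -/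
def liftLoweredCurvature (T : ι → ι → ι → ι → ℝ) : ι ⊕ ι → ι ⊕ ι → ι ⊕ ι → ι ⊕ ι → ℝ
  | .inl l, .inl k, .inl i, .inl j => (1 / 2) * (T l i j k - T l j i k)
  | .inl l, .inl k, .inr i, .inr j => (1 / 2) * (T l i j k - T l j i k)
  | .inl l, .inr k, .inl i, .inr j => -(1 / 2) * (T l i j k + T l j i k)
  | .inl l, .inr k, .inr i, .inl j => (1 / 2) * (T l i j k + T l j i k)
  | .inr l, .inr k, .inl i, .inl j => (1 / 2) * (T l i j k - T l j i k)
  | .inr l, .inr k, .inr i, .inr j => (1 / 2) * (T l i j k - T l j i k)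
  | .inr l, .inl k, .inl i, .inr j => (1 / 2) * (T l i j k + T l j i k)
  | .inr l, .inl k, .inr i, .inl j => -(1 / 2) * (T l i j k + T l j i k)
  | _, _, _, _ => 0

/-- In each nonvanishing block the terms quadratic in `γ` form, up to sign, the antisymmetrized
product of `lowered_sub_lowered`, that is `∓½ (T_lijk - T_ljik)`. Derivatives along the base
contribute `±T`, derivatives along the fibre nothing; this decides whether the result is a
difference or a sum. -/
lemma IsHessianOn.lowered_curvature_liftMetric {g : Model κ ι → Matrix ι ι ℝ}
    {U : Set (Model κ ι)} {Z : Model κ (ι ⊕ ι)} (hg : IsHessianOn g U) (hZ : basePoint Z ∈ U)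
    (l k i j : ι ⊕ ι) :
    ∑ n, liftMetric g Z l n * curvature (christoffel (liftMetric g)) Z n k i j =
      liftLoweredCurvature (loweredHessianCurvature g (basePoint Z)) l k i j := by
  have hc := fun a b c => (hg.contDiffAt_christoffel hZ a b c).differentiableAt (by simp)
  have h1 : ∀ a b c d, tderiv (Sum.inl d) (fun W => christoffel g (basePoint W) a b c) Z =
      tderiv d (fun w => christoffel g w a b c) (basePoint Z) := fun a b c d =>
    tderiv_inl (hc a b c) d
  have h2 : ∀ a b c d, tderiv (Sum.inr d) (fun W => christoffel g (basePoint W) a b c) Z = 0 :=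
    fun a b c d => tderiv_inr (hc a b c) d
  have hT : ∀ l i j k, ∑ n, g (basePoint Z) l n *
      tderiv i (fun w => christoffel g w n j k) (basePoint Z) =
      loweredHessianCurvature g (basePoint Z) l i j k := fun _ _ _ _ => rfl
  have hP := fun l k i j => hg.lowered_sub_lowered hZ l k i j
  simp only [hg.curvature_liftMetric hZ, Fintype.sum_sum_type]
  rcases l with l | l <;> rcases k with k | k <;> rcases i with i | i <;> rcases j with j | j <;>
    simp only [liftMetric, liftLoweredCurvature, Matrix.fromBlocks_apply₁₁,
      Matrix.fromBlocks_apply₁₂, Matrix.fromBlocks_apply₂₁,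
      Matrix.fromBlocks_apply₂₂, Matrix.zero_apply, zero_mul, Finset.sum_const_zero, add_zero,
      zero_add, h1, h2, tderiv_const, tderiv_neg, sub_self, mul_zero, liftChristoffel, sub_zero,
      zero_sub, mul_neg, neg_mul, neg_zero, mul_add, mul_sub, Finset.sum_add_distrib,
      Finset.sum_sub_distrib, Finset.sum_neg_distrib, hT] at hP ⊢ <;>
    linarith [hP l k i j]

end Lift

end TransverseHessian

namespace TransverseHessian

/-! ### Algebraic curvature tensors of Hessian type -/

section Algebra

variable {ι : Type*} [Fintype ι]

/-- The bilinear form `(ξ, η) ↦ ∑ E_lijk ξ^li η^jk` on contravariant two-tensors. -/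
def contract (E : ι → ι → ι → ι → ℝ) (ξ η : Matrix ι ι ℝ) : ℝ :=
  ∑ l, ∑ i, ∑ j, ∑ k, E l i j k * (ξ l i * η j k)

/-- The value on `w = a + √-1 b` of the biquadratic form `∑ E_lijk w^l w^i w̄^j w̄^k`. -/
def hermitianForm (E : ι → ι → ι → ι → ℝ) (a b : ι → ℝ) : ℝ :=
  contract E (Matrix.vecMulVec a a) (Matrix.vecMulVec a a) +
    contract E (Matrix.vecMulVec b b) (Matrix.vecMulVec b b) -
    2 * contract E (Matrix.vecMulVec a a) (Matrix.vecMulVec b b) +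
    4 * contract E (Matrix.vecMulVec a b) (Matrix.vecMulVec a b)

/-- The symmetries of the lowered Hessian curvature. -/
structure IsHessianTensor (E : ι → ι → ι → ι → ℝ) : Prop where
  comm : ∀ l i j k, E l i j k = E i l j k
  swap : ∀ l i j k, E l i j k = E j k l i

lemma contract_add_left (E : ι → ι → ι → ι → ℝ) (ξ ξ' η : Matrix ι ι ℝ) :
    contract E (ξ + ξ') η = contract E ξ η + contract E ξ' η := by
  simp only [contract, ← Finset.sum_add_distrib, Matrix.add_apply]
  congr! 4
  ring

lemma contract_add_right (E : ι → ι → ι → ι → ℝ) (ξ η η' : Matrix ι ι ℝ) :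
    contract E ξ (η + η') = contract E ξ η + contract E ξ η' := by
  simp only [contract, ← Finset.sum_add_distrib, Matrix.add_apply]
  congr! 4
  ring

lemma contract_smul_left (E : ι → ι → ι → ι → ℝ) (r : ℝ) (ξ η : Matrix ι ι ℝ) :
    contract E (r • ξ) η = r * contract E ξ η := by
  simp only [contract, Finset.mul_sum, Matrix.smul_apply, smul_eq_mul]
  congr! 4
  ring

lemma contract_smul_right (E : ι → ι → ι → ι → ℝ) (r : ℝ) (ξ η : Matrix ι ι ℝ) :
    contract E ξ (r • η) = r * contract E ξ η := by
  simp only [contract, Finset.mul_sum, Matrix.smul_apply, smul_eq_mul]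
  congr! 4
  ring

lemma contract_sub_left (E : ι → ι → ι → ι → ℝ) (ξ ξ' η : Matrix ι ι ℝ) :
    contract E (ξ - ξ') η = contract E ξ η - contract E ξ' η := by
  simp only [contract, ← Finset.sum_sub_distrib, Matrix.sub_apply]
  congr! 4
  ring

lemma contract_sub_right (E : ι → ι → ι → ι → ℝ) (ξ η η' : Matrix ι ι ℝ) :
    contract E ξ (η - η') = contract E ξ η - contract E ξ η' := by
  simp only [contract, ← Finset.sum_sub_distrib, Matrix.sub_apply]
  congr! 4
  ring

lemma contract_zero_left (E : ι → ι → ι → ι → ℝ) (η : Matrix ι ι ℝ) : contract E 0 η = 0 := by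
  simp [contract]

lemma contract_zero_right (E : ι → ι → ι → ι → ℝ) (ξ : Matrix ι ι ℝ) : contract E ξ 0 = 0 := by
  simp [contract]

lemma contract_sub_smul (E G : ι → ι → ι → ι → ℝ) (c : ℝ) (ξ η : Matrix ι ι ℝ) :
    contract (fun l i j k => E l i j k - c * G l i j k) ξ η =
      contract E ξ η - c * contract G ξ η := by
  simp only [contract, Finset.mul_sum, ← Finset.sum_sub_distrib]
  congr! 4
  ring

lemma hermitianForm_sub_smul (E G : ι → ι → ι → ι → ℝ) (c : ℝ) (a b : ι → ℝ) :
    hermitianForm (fun l i j k => E l i j k - c * G l i j k) a b =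
      hermitianForm E a b - c * hermitianForm G a b := by
  simp only [hermitianForm, contract_sub_smul]
  ring

/-- Symmetric matrices are spanned by the squares `v ⊗ v`. -/
lemma mem_span_squares {ξ : Matrix ι ι ℝ} (hξ : ξ.IsSymm) :
    ξ ∈ Submodule.span ℝ (range fun v : ι → ℝ => Matrix.vecMulVec v v) := by
  classical
  set P := Submodule.span ℝ (range fun v : ι → ℝ => Matrix.vecMulVec v v)
  have hsq : ∀ v : ι → ℝ, Matrix.vecMulVec v v ∈ P := fun v => Submodule.subset_span ⟨v, rfl⟩
  -- Polarization: `e_i⊗e_j + e_j⊗e_i = (e_i + e_j)² - e_i² - e_j²`.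
  have hp : ∀ i j : ι, Matrix.single i j (1 : ℝ) + Matrix.single j i 1 ∈ P := fun i j => by
    have h := P.sub_mem (P.sub_mem (hsq (Pi.single i 1 + Pi.single j 1)) (hsq (Pi.single i 1)))
      (hsq (Pi.single j 1))
    convert h using 1
    rw [Matrix.add_vecMulVec, Matrix.vecMulVec_add, Matrix.vecMulVec_add,
      Matrix.single_eq_single_vecMulVec_single, Matrix.single_eq_single_vecMulVec_single]
    abel
  have h : ξ = ∑ i, ∑ j, (ξ i j / 2) • (Matrix.single i j (1 : ℝ) + Matrix.single j i 1) := by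
    simp only [smul_add, Finset.sum_add_distrib, Matrix.smul_single, smul_eq_mul, mul_one]
    rw [Finset.sum_comm (f := fun i j => Matrix.single j i (ξ i j / 2))]
    have h1 : ∀ i j, ξ i j = ξ j i := fun i j => hξ.apply j i
    simp only [← Finset.sum_add_distrib]
    conv_lhs => rw [Matrix.matrix_eq_sum_single ξ]
    refine Finset.sum_congr rfl fun i _ => Finset.sum_congr rfl fun j _ => ?_
    rw [h1 j i, ← Matrix.single_add, add_halves]
  rw [h]
  exact P.sum_mem fun i _ => P.sum_mem fun j _ => P.smul_mem _ (hp i j)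

namespace IsHessianTensor

variable {E : ι → ι → ι → ι → ℝ}

lemma contract_comm (hE : IsHessianTensor E) (ξ η : Matrix ι ι ℝ) :
    contract E ξ η = contract E η ξ := by
  simp only [contract]
  calc _ = ∑ l, ∑ j, ∑ i, ∑ k, E l i j k * (ξ l i * η j k) :=
        Finset.sum_congr rfl fun _ _ => Finset.sum_comm
    _ = ∑ j, ∑ l, ∑ i, ∑ k, E l i j k * (ξ l i * η j k) := Finset.sum_comm
    _ = ∑ j, ∑ l, ∑ k, ∑ i, E l i j k * (ξ l i * η j k) :=
        Finset.sum_congr rfl fun _ _ => Finset.sum_congr rfl fun _ _ => Finset.sum_comm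
    _ = ∑ j, ∑ k, ∑ l, ∑ i, E l i j k * (ξ l i * η j k) :=
        Finset.sum_congr rfl fun _ _ => Finset.sum_comm
    _ = _ := by
        congr! 4 with j _ k _ l _ i
        rw [hE.swap]
        ring

lemma contract_transpose_left (hE : IsHessianTensor E) (ξ η : Matrix ι ι ℝ) :
    contract E ξᵀ η = contract E ξ η := by
  simp only [contract]
  rw [Finset.sum_comm]
  congr! 4
  rw [hE.comm]
  rfl

lemma contract_transpose_right (hE : IsHessianTensor E) (ξ η : Matrix ι ι ℝ) :
    contract E ξ ηᵀ = contract E ξ η := by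
  rw [hE.contract_comm, hE.contract_transpose_left, hE.contract_comm]

/-- For `w = a + √-1 b`, the two arguments are the real and imaginary parts of `w⊗w`, and a
symmetric real form evaluated on `(ζ, ζ̄)` is the sum of its values on the real and imaginary parts
of `ζ`. -/
lemma hermitianForm_eq (hE : IsHessianTensor E) (a b : ι → ℝ) :
    hermitianForm E a b =
      contract E (Matrix.vecMulVec a a - Matrix.vecMulVec b b)
          (Matrix.vecMulVec a a - Matrix.vecMulVec b b) +
        contract E (Matrix.vecMulVec a b + Matrix.vecMulVec b a)
          (Matrix.vecMulVec a b + Matrix.vecMulVec b a) := by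
  have h : Matrix.vecMulVec b a = (Matrix.vecMulVec a b)ᵀ := by
    rw [Matrix.transpose_vecMulVec]
  rw [h]
  simp only [contract_sub_left, contract_sub_right, contract_add_left, contract_add_right,
    hE.contract_transpose_left, hE.contract_transpose_right, hermitianForm]
  rw [hE.contract_comm (Matrix.vecMulVec b b) (Matrix.vecMulVec a a)]
  ring

/-- Polarization: a tensor of Hessian type vanishes on symmetric two-tensors if and only if its
biquadratic form vanishes. -/
theorem contract_eq_zero_iff (hE : IsHessianTensor E) :
    (∀ ξ : Matrix ι ι ℝ, ξ.IsSymm → contract E ξ ξ = 0) ↔ ∀ a b, hermitianForm E a b = 0 := by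
  constructor
  · intro h a b
    rw [hE.hermitianForm_eq, h, h, add_zero]
    · rw [Matrix.IsSymm, Matrix.transpose_add, Matrix.transpose_vecMulVec,
        Matrix.transpose_vecMulVec, add_comm]
    · rw [Matrix.IsSymm, Matrix.transpose_sub, Matrix.transpose_vecMulVec,
        Matrix.transpose_vecMulVec]
  · intro h
    have h4 : ∀ a, contract E (Matrix.vecMulVec a a) (Matrix.vecMulVec a a) = 0 := fun a => by
      have := h a 0
      simpa [hermitianForm, contract_zero_left, contract_zero_right] using this
    -- Adding the quartic identities for `a + b` and `a - b` removes the odd terms and gives `E(aa,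
    -- bb) + 2 E(ab, ab) = 0`, while the complex vector `a + √-1 b` gives `-2 E(aa, bb) + 4 E(ab,
    -- ab) = 0`. The two equations are independent, so real vectors alone would not suffice.
    have h22 : ∀ a b, contract E (Matrix.vecMulVec a a) (Matrix.vecMulVec b b) = 0 := by
      intro a b
      have e := h a b
      have ep := h4 (a + b)
      have em := h4 (a + (-1 : ℝ) • b)
      have ht : Matrix.vecMulVec b a = (Matrix.vecMulVec a b)ᵀ := by
        rw [Matrix.transpose_vecMulVec]
      simp only [Matrix.add_vecMulVec, Matrix.vecMulVec_add, Matrix.smul_vecMulVec,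
        Matrix.vecMulVec_smul, ht, contract_add_left, contract_add_right,
        contract_smul_left, contract_smul_right, hE.contract_transpose_left,
        hE.contract_transpose_right, h4,
        hE.contract_comm (Matrix.vecMulVec b b) (Matrix.vecMulVec a a)] at ep em
      simp only [hermitianForm, h4] at e
      linarith
    -- Squares span the symmetric tensors; vanishing on pairs of squares extends by linearity one
    -- slot at a time.
    have hl : ∀ ξ ∈ Submodule.span ℝ (range fun v : ι → ℝ => Matrix.vecMulVec v v), ∀ b,
        contract E ξ (Matrix.vecMulVec b b) = 0 := fun ξ hξ b => by
      induction hξ using Submodule.span_induction with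
      | mem x hx => obtain ⟨v, rfl⟩ := hx; exact h22 v b
      | zero => exact contract_zero_left _ _
      | add x y _ _ hx hy => rw [contract_add_left, hx, hy, add_zero]
      | smul r x _ hx => rw [contract_smul_left, hx, mul_zero]
    intro ξ hξ
    have key : ∀ η ∈ Submodule.span ℝ (range fun v : ι → ℝ => Matrix.vecMulVec v v),
        contract E ξ η = 0 := fun η hη => by
      induction hη using Submodule.span_induction with
      | mem x hx => obtain ⟨v, rfl⟩ := hx; exact hl ξ (mem_span_squares hξ) v
      | zero => exact contract_zero_right _ _
      | add x y _ _ hx hy => rw [contract_add_right, hx, hy, add_zero]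
      | smul r x _ hx => rw [contract_smul_right, hx, mul_zero]
    exact key ξ (mem_span_squares hξ)

end IsHessianTensor

/-- The Hessian type tensor `(g_lj g_ik + g_lk g_ij) / 2` of the metric `g`. -/
def metricTensor (g : Matrix ι ι ℝ) (l i j k : ι) : ℝ :=
  (1 / 2) * (g l j * g i k + g l k * g i j)

lemma isHessianTensor_metricTensor {g : Matrix ι ι ℝ} (hg : ∀ i j, g i j = g j i) :
    IsHessianTensor (metricTensor g) where
  comm l i j k := by simp only [metricTensor]; ring
  swap l i j k := by
    simp only [metricTensor]
    rw [hg l j, hg i k, hg l k, hg i j]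
    ring

lemma IsHessianTensor.sub_smul {E G : ι → ι → ι → ι → ℝ} (hE : IsHessianTensor E)
    (hG : IsHessianTensor G) (c : ℝ) : IsHessianTensor fun l i j k => E l i j k - c * G l i j k where
  comm l i j k := by rw [hE.comm, hG.comm]
  swap l i j k := by rw [hE.swap, hG.swap]

/-- The two halves of `metricTensor` contribute equally because `ξ` is symmetric. -/
lemma contract_metricTensor (g : Matrix ι ι ℝ) {ξ : Matrix ι ι ℝ} (hξ : ξ.IsSymm) :
    contract (metricTensor g) ξ ξ = inner₂ g ξ ξ := by
  have h : inner₂ g ξ ξ = ∑ l, ∑ i, ∑ j, ∑ k, g l k * g i j * ξ l i * ξ j k := by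
    simp only [inner₂]
    refine Finset.sum_congr rfl fun l _ => Finset.sum_congr rfl fun i _ => ?_
    rw [Finset.sum_comm]
    congr! 2 with j _ k
    rw [hξ.apply j k]
  have h2 : contract (metricTensor g) ξ ξ = (1 / 2) * (inner₂ g ξ ξ + inner₂ g ξ ξ) := by
    nth_rewrite 2 [h]
    simp only [contract, inner₂, metricTensor, Finset.mul_sum, ← Finset.sum_add_distrib]
    congr! 4
    ring
  rw [h2]
  ring

lemma contract_metricTensor_vecMulVec (g : Matrix ι ι ℝ) (a b c d : ι → ℝ) :
    contract (metricTensor g) (Matrix.vecMulVec a b) (Matrix.vecMulVec c d) =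
      (1 / 2) * (inner₁ g a c * inner₁ g b d + inner₁ g a d * inner₁ g b c) := by
  have h1 : inner₁ g a c * inner₁ g b d =
      ∑ l, ∑ i, ∑ j, ∑ k, (g l j * a l * c j) * (g i k * b i * d k) := by
    simp only [inner₁, Finset.sum_mul_sum]
  have h2 : inner₁ g a d * inner₁ g b c =
      ∑ l, ∑ i, ∑ j, ∑ k, (g l k * a l * d k) * (g i j * b i * c j) := by
    simp only [inner₁, Finset.sum_mul_sum]
    refine Finset.sum_congr rfl fun l _ => Finset.sum_congr rfl fun i _ => Finset.sum_comm
  rw [h1, h2]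
  simp only [contract, metricTensor, Finset.mul_sum, ← Finset.sum_add_distrib,
    Matrix.vecMulVec_apply]
  congr! 4
  ring

lemma inner₁_comm {g : Matrix ι ι ℝ} (hg : ∀ i j, g i j = g j i) (a b : ι → ℝ) :
    inner₁ g a b = inner₁ g b a := by
  rw [inner₁, Finset.sum_comm, inner₁]
  congr! 2 with i _ j
  rw [hg]
  ring

/-- The contributions of `g(a, b)²`, namely `-2` from the mixed term and `+2` from `4 · ½`, cancel.
This is what normalizes the constant of the holomorphic curvature. -/
lemma hermitianForm_metricTensor {g : Matrix ι ι ℝ} (hg : ∀ i j, g i j = g j i) (a b : ι → ℝ) :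
    hermitianForm (metricTensor g) a b = (inner₁ g a a + inner₁ g b b) ^ 2 := by
  simp only [hermitianForm, contract_metricTensor_vecMulVec]
  rw [inner₁_comm hg b a]
  ring

lemma inner₁_fromBlocks (g : Matrix ι ι ℝ) (a b a' b' : ι → ℝ) :
    inner₁ (Matrix.fromBlocks g 0 0 g) (Sum.elim a b) (Sum.elim a' b') =
      inner₁ g a a' + inner₁ g b b' := by
  simp [inner₁, Fintype.sum_sum_type]

/-- Here `w = Jv`, and the left side is the numerator of the sectional curvature of a complex line.
All block contributions reduce to the few values of `E` on products of `a` and `b` left by its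
symmetries. -/
lemma IsHessianTensor.sum_liftLoweredCurvature {E : ι → ι → ι → ι → ℝ} (hE : IsHessianTensor E)
    (a b : ι → ℝ) (v w : ι ⊕ ι → ℝ) (hv : v = Sum.elim a b) (hw : w = Sum.elim (-b) a) :
    ∑ l, ∑ k, ∑ i, ∑ j, liftLoweredCurvature E l k i j * (v l * w k * v i * w j) =
      -hermitianForm E a b := by
  set F : (x u s y : ι → ℝ) → ℝ := fun x u s y =>
    ∑ l, ∑ k, ∑ i, ∑ j, E l i j k * (x l * u i * s j * y k) with hF
  set F' : (x u s y : ι → ℝ) → ℝ := fun x u s y =>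
    ∑ l, ∑ k, ∑ i, ∑ j, E l j i k * (x l * u j * s i * y k) with hF'
  have hswap : ∀ x u s y, F' x u s y = F x u s y :=
    fun x u s y => Finset.sum_congr rfl fun l _ => Finset.sum_congr rfl fun k _ => Finset.sum_comm
  have hc : ∀ x u s y, F x u s y = contract E (Matrix.vecMulVec x u) (Matrix.vecMulVec s y) := by
    intro x u s y
    simp only [hF, contract, Matrix.vecMulVec_apply]
    refine Finset.sum_congr rfl fun l _ => ?_
    rw [Finset.sum_comm]
    refine Finset.sum_congr rfl fun i _ => ?_
    rw [Finset.sum_comm]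
    congr! 2
    ring
  -- Each of the eight nonzero blocks contributes one `F` and one `F'`, with the sign of `-b`
  -- absorbed.
  have hsum : ∑ l, ∑ k, ∑ i, ∑ j, liftLoweredCurvature E l k i j * (v l * w k * v i * w j) =
      (1 / 2) * (F a a b b - F' a b a b - F a b a b + F' a a b b - F a a a a - F' a a a a
        - F a b b a - F' a b b a - F b a b a + F' b b a a + F b b a a - F' b a b a
        - F b a a b - F' b a a b - F b b b b - F' b b b b) := by
    subst hv hw
    simp only [Fintype.sum_sum_type, liftLoweredCurvature, Sum.elim_inl, Sum.elim_inr,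
      Finset.sum_add_distrib, zero_mul, Finset.sum_const_zero, add_zero, zero_add]
    simp only [hF, hF', Finset.mul_sum, ← Finset.sum_add_distrib, ← Finset.sum_sub_distrib,
      Pi.neg_apply]
    congr! 4
    ring
  have ht : Matrix.vecMulVec b a = (Matrix.vecMulVec a b)ᵀ := by rw [Matrix.transpose_vecMulVec]
  rw [hsum]
  simp only [hswap, hc, hermitianForm, ht, hE.contract_transpose_left, hE.contract_transpose_right]
  rw [hE.contract_comm (Matrix.vecMulVec b b) (Matrix.vecMulVec a a)]
  ring

end Algebra

end TransverseHessian

namespace TransverseHessian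

/-! ### Hessian structures in affine charts -/

section Affine

variable {κ ι : Type*} [Fintype κ] [Fintype ι] [DecidableEq ι]

lemma fderiv_eq_sum_tderiv {f : Model κ ι → ℝ} {z : Model κ ι}
    (hf : ∀ a : κ → ℝ, fderiv ℝ f z (a, 0) = 0) (u : Model κ ι) :
    fderiv ℝ f z u = ∑ c, u.2 c * tderiv c f z := by
  have h : u = (u.1, 0) + ∑ c, u.2 c • ((0, Pi.single c 1) : Model κ ι) := by
    refine Prod.ext ?_ ?_
    · simp [Prod.fst_sum]
    · funext i
      simp [Prod.snd_sum, Finset.sum_apply, Pi.single_apply]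
  conv_lhs => rw [h]
  rw [map_add, hf, zero_add, map_sum]
  exact Finset.sum_congr rfl fun c _ => by rw [map_smul, smul_eq_mul, tderiv]

lemma FoliatedAtlas.differentiableAt_jacobian {M A : Type*} [TopologicalSpace M]
    (𝒜 : FoliatedAtlas κ ι M A) (e e' : A) {z : Model κ ι} (hz : z ∈ (𝒜.transition e e').source)
    (c j : ι) : DifferentiableAt ℝ (fun w => 𝒜.jacobian e e' w c j) z := by
  have h : (fun w => 𝒜.jacobian e e' w c j) =ᶠ[𝓝 z]
      fun w => 𝒜.normalDeriv e e' w (Pi.single j 1) c := by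
    filter_upwards [(𝒜.transition e e').open_source.mem_nhds hz] with w hw
    rw [𝒜.jacobian_apply hw]
    rfl
  refine DifferentiableAt.congr_of_eventuallyEq ?_ h
  have h1 := ((𝒜.contDiffAt_normalDeriv e e' hz).differentiableAt (by simp)).clm_apply
    (differentiableAt_const (Pi.single j (1 : ℝ)))
  exact differentiableAt_pi.1 h1 c

/-- The chain rule for the pullback of a basic function by a change of adapted charts. -/
lemma FoliatedAtlas.tderiv_comp_transition {M A : Type*} [TopologicalSpace M]
    (𝒜 : FoliatedAtlas κ ι M A) (e e' : A) {z : Model κ ι} (hz : z ∈ (𝒜.transition e e').source)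
    {f : Model κ ι → ℝ} (hf : DifferentiableAt ℝ f (𝒜.transition e e' z))
    (hb : ∀ a : κ → ℝ, fderiv ℝ f (𝒜.transition e e' z) (a, 0) = 0) (k : ι) :
    DifferentiableAt ℝ (fun w => f (𝒜.transition e e' w)) z ∧
    tderiv k (fun w => f (𝒜.transition e e' w)) z =
      ∑ c, 𝒜.jacobian e e' z c k * tderiv c f (𝒜.transition e e' z) := by
  have h := hf.hasFDerivAt.comp z (𝒜.differentiableAt_transition e e' hz).hasFDerivAt
  refine ⟨h.differentiableAt, ?_⟩
  change fderiv ℝ (f ∘ 𝒜.transition e e') z _ = _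
  rw [h.fderiv, ContinuousLinearMap.comp_apply, fderiv_eq_sum_tderiv hb]
  exact Finset.sum_congr rfl fun c _ => by rw [𝒜.jacobian_apply hz]

end Affine

namespace FoliatedHessianStructure

variable {κ ι : Type*} [Fintype κ] [Fintype ι] [DecidableEq ι]
  {M : Type*} [TopologicalSpace M] [ChartedSpace (Model κ ι) M]
  [HasGroupoid M (foliationGroupoid κ ι)] (S : FoliatedHessianStructure κ ι M)

/-- Changes of affine charts have locally constant transverse Jacobian matrices. -/
lemma tderiv_jacobian_eq_zero {e e' : (foliationGroupoid κ ι).maximalAtlas M}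
    (he : S.D.IsAffineChart e) (he' : S.D.IsAffineChart e') {z : Model κ ι}
    (hz : z ∈ ((adaptedAtlas κ ι M).transition e e').source) (c i j : ι) :
    tderiv i (fun w => (adaptedAtlas κ ι M).jacobian e e' w c j) z = 0 := by
  have h := S.D.transform e e' z hz c i j
  have hs := (adaptedAtlas κ ι M).mem_transition_source.1 hz
  have h1 : ∀ k i j, S.D.comp e z k i j = 0 := he z hs.1
  have h2 : ∀ k i j, S.D.comp e' ((adaptedAtlas κ ι M).transition e e' z) k i j = 0 :=
    he' _ (((adaptedAtlas κ ι M).chart e').map_source hs.2)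
  simp only [h1, h2, zero_mul, mul_zero, Finset.sum_const_zero, add_zero] at h
  exact h.symm

/-- In `g = Jᵀ g' J` the Jacobian between affine charts is transversally locally constant, so `∂g`
transforms as a trilinear form. -/
lemma tderiv_metric_transition {e e' : (foliationGroupoid κ ι).maximalAtlas M}
    (he : S.D.IsAffineChart e) (he' : S.D.IsAffineChart e') {z : Model κ ι}
    (hz : z ∈ ((adaptedAtlas κ ι M).transition e e').source) (i j k : ι) :
    tderiv k (fun w => S.g.comp e w i j) z =
      ∑ b, (∑ a, (adaptedAtlas κ ι M).jacobian e e' z a i *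
        ∑ c, (adaptedAtlas κ ι M).jacobian e e' z c k *
          tderiv c (fun w => S.g.comp e' w a b) ((adaptedAtlas κ ι M).transition e e' z)) *
        (adaptedAtlas κ ι M).jacobian e e' z b j := by
  set 𝒜 := adaptedAtlas κ ι M
  set J := 𝒜.jacobian e e'
  have hz' : 𝒜.transition e e' z ∈ (𝒜.chart e').target :=
    (𝒜.chart e').map_source (𝒜.mem_transition_source.1 hz).2
  have hg : ∀ a b, DifferentiableAt ℝ (fun w => S.g.comp e' w a b) (𝒜.transition e e' z) :=
    fun a b => ((S.g.smooth e' a b).contDiffAt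
      ((𝒜.chart e').open_target.mem_nhds hz')).differentiableAt (by simp)
  have hG := fun a b => 𝒜.tderiv_comp_transition e e' hz (hg a b) (S.g.basic e' a b _ hz') k
  have hJ : ∀ a b, DifferentiableAt ℝ (fun w => J w a b) z := 𝒜.differentiableAt_jacobian e e' hz
  have hJ0 : ∀ a b, tderiv k (fun w => J w a b) z = 0 := fun a b =>
    S.tderiv_jacobian_eq_zero he he' hz a k b
  have h : (fun w => S.g.comp e w i j) =ᶠ[𝓝 z] fun w =>
      ∑ b, (∑ a, J w a i * S.g.comp e' (𝒜.transition e e' w) a b) * J w b j := by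
    filter_upwards [(𝒜.transition e e').open_source.mem_nhds hz] with w hw
    rw [S.g.transform e e' w hw]
    simp only [Matrix.mul_apply, Matrix.transpose_apply]
    rfl
  have hd : ∀ b, DifferentiableAt ℝ
      (fun w => ∑ a, J w a i * S.g.comp e' (𝒜.transition e e' w) a b) z :=
    fun b => DifferentiableAt.fun_sum fun a _ => (hJ a i).mul (hG a b).1
  rw [tderiv_congr h, tderiv_sum fun b _ => (hd b).fun_mul (hJ b j)]
  refine Finset.sum_congr rfl fun b _ => ?_
  rw [tderiv_mul (hd b) (hJ b j), hJ0, mul_zero, add_zero,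
    tderiv_sum fun a _ => (hJ a i).fun_mul (hG a b).1]
  congr 1
  refine Finset.sum_congr rfl fun a _ => ?_
  rw [tderiv_mul (hJ a i) (hG a b).1, hJ0, zero_mul, zero_add, (hG a b).2]

/-- In every affine chart, the derivatives `∂g_ij/∂y^k` of the metric are totally symmetric. -/
lemma isHessianOn {e : (foliationGroupoid κ ι).maximalAtlas M} (he : S.D.IsAffineChart e) :
    IsHessianOn (S.g.comp e) ((adaptedAtlas κ ι M).chart e).target where
  isOpen := ((adaptedAtlas κ ι M).chart e).open_target
  smooth := S.g.smooth e
  posDef := S.g.posDef e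
  tderiv_swap z hz i j k := by
    -- The potential lives in an affine chart `e'` that may differ from `e`; the symmetry of third
    -- derivatives is proved there and carried back.
    obtain ⟨e', he', hx, h, hh, -, hgh⟩ := S.hessian (((adaptedAtlas κ ι M).chart e).symm z)
    have hz' : z ∈ ((adaptedAtlas κ ι M).transition e e').source :=
      (adaptedAtlas κ ι M).mem_transition_source.2 ⟨hz, hx⟩
    rw [S.tderiv_metric_transition he he' hz', S.tderiv_metric_transition he he' hz']
    have ht : (adaptedAtlas κ ι M).transition e e' z ∈ ((adaptedAtlas κ ι M).chart e').target :=
      ((adaptedAtlas κ ι M).chart e').map_source hx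
    have hn := ((adaptedAtlas κ ι M).chart e').open_target.mem_nhds ht
    have hsymm : ∀ a b c, tderiv c (fun w => S.g.comp e' w a b)
        ((adaptedAtlas κ ι M).transition e e' z) =
        tderiv a (fun w => S.g.comp e' w c b) ((adaptedAtlas κ ι M).transition e e' z) := by
      intro a b c
      have h1 : ∀ a, (fun w => S.g.comp e' w a b) =ᶠ[𝓝 ((adaptedAtlas κ ι M).transition e e' z)]
          tderiv a (tderiv b h) := fun a => Filter.eventually_of_mem hn fun w hw => hgh w hw a b
      rw [tderiv_congr (h1 a), tderiv_congr (h1 c)]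
      exact tderiv_comm (contDiffAt_tderiv (hh.contDiffAt hn) b) c a
    refine Finset.sum_congr rfl fun b _ => ?_
    congr 1
    simp only [Finset.mul_sum]
    rw [Finset.sum_comm]
    refine Finset.sum_congr rfl fun c _ => Finset.sum_congr rfl fun a _ => ?_
    rw [hsymm a b c]
    ring

lemma isHessianTensor {e : (foliationGroupoid κ ι).maximalAtlas M} (he : S.D.IsAffineChart e)
    {z : Model κ ι} (hz : z ∈ ((adaptedAtlas κ ι M).chart e).target) :
    IsHessianTensor (loweredHessianCurvature (S.g.comp e) z) where
  comm := (S.isHessianOn he).lowered_comm_left hz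
  swap := (S.isHessianOn he).lowered_swap hz

lemma hessianCurvature_eq {e : (foliationGroupoid κ ι).maximalAtlas M} (he : S.D.IsAffineChart e)
    {z : Model κ ι} (hz : z ∈ ((adaptedAtlas κ ι M).chart e).target) (i j k l : ι) :
    S.hessianCurvature e z i j k l =
      tderiv k (fun w => christoffel (S.g.comp e) w i j l) z := by
  have h : (fun w => S.gamma e w i j l) =ᶠ[𝓝 z] fun w => christoffel (S.g.comp e) w i j l :=
    Filter.eventually_of_mem (((adaptedAtlas κ ι M).chart e).open_target.mem_nhds hz)
      fun w hw => by
        change christoffel (S.g.comp e) w i j l - S.D.comp e w i j l = _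
        rw [he w hw, sub_zero]
  rw [hessianCurvature, tderiv_congr h]
  simp [he z hz]

/-- One factor `g` of the inner product cancels the inverse metric that raises an index in `Q̂`; the
other lowers the upper index of `Q`. -/
lemma inner₂_hessianCurvatureOp {e : (foliationGroupoid κ ι).maximalAtlas M}
    (he : S.D.IsAffineChart e) {z : Model κ ι}
    (hz : z ∈ ((adaptedAtlas κ ι M).chart e).target) (ξ : Matrix ι ι ℝ) :
    inner₂ (S.g.comp e z) (S.hessianCurvatureOp e z ξ) ξ =
      contract (loweredHessianCurvature (S.g.comp e) z) ξ ξ := by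
  have hg := S.isHessianOn he
  set g := S.g.comp e
  have hinv : ∀ (b : ι) (f : ι → ℝ), ∑ k, g z k b * ∑ m, (g z)⁻¹ k m * f m = f b := by
    intro b f
    have h : g z *ᵥ ((g z)⁻¹ *ᵥ f) = f := by
      rw [Matrix.mulVec_mulVec, Matrix.mul_nonsing_inv _ (hg.isUnit_det hz), Matrix.one_mulVec]
    have h1 := congrFun h b
    simp only [Matrix.mulVec, dotProduct] at h1
    rw [← h1]
    exact Finset.sum_congr rfl fun k _ => by rw [hg.symm hz]
  have hop : ∀ i b, ∑ k, g z k b * S.hessianCurvatureOp e z ξ i k =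
      ∑ j, ∑ l, S.hessianCurvature e z i j b l * ξ j l := by
    intro i b
    rw [← hinv b fun m => ∑ j, ∑ l, S.hessianCurvature e z i j m l * ξ j l]
    refine Finset.sum_congr rfl fun k _ => ?_
    congr 1
    simp only [hessianCurvatureOp, Matrix.of_apply, Finset.mul_sum, Finset.sum_mul]
    conv_rhs => rw [Finset.sum_comm]
    refine Finset.sum_congr rfl fun j _ => ?_
    rw [Finset.sum_comm]
    congr! 2
    ring
  calc _ = ∑ a, ∑ b, ∑ i, g z i a * ξ a b * ∑ k, g z k b * S.hessianCurvatureOp e z ξ i k := by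
        simp only [inner₂, Finset.mul_sum]
        rw [Finset.sum_congr rfl fun i _ => Finset.sum_comm, Finset.sum_comm]
        refine Finset.sum_congr rfl fun a _ => ?_
        rw [Finset.sum_congr rfl fun i _ => Finset.sum_comm, Finset.sum_comm]
        congr! 3
        ring
    _ = _ := by
        simp only [hop, contract, loweredHessianCurvature, Finset.mul_sum, Finset.sum_mul,
          S.hessianCurvature_eq he hz]
        refine Finset.sum_congr rfl fun a _ => Finset.sum_congr rfl fun b _ => ?_
        rw [Finset.sum_comm]
        refine Finset.sum_congr rfl fun j _ => ?_
        rw [Finset.sum_comm]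
        congr! 2 with l _ i
        rw [hg.symm hz a i]
        ring

end FoliatedHessianStructure

/-! ### Holomorphic sectional curvature of the lift, and positivity of the inner products -/

lemma inner₁_curvature {σ : Type*} [Fintype σ] {g : Matrix σ σ ℝ} (hg : ∀ i j, g i j = g j i)
    (R : σ → σ → σ → σ → ℝ) (v w : σ → ℝ) :
    inner₁ g (fun l => ∑ k, ∑ i, ∑ j, R l k i j * v i * w j * w k) v =
      ∑ l, ∑ k, ∑ i, ∑ j, (∑ n, g l n * R n k i j) * (v l * w k * v i * w j) := by
  rw [inner₁_comm hg]
  simp only [inner₁, Finset.mul_sum, Finset.sum_mul]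
  refine Finset.sum_congr rfl fun l _ => ?_
  rw [Finset.sum_comm]
  refine Finset.sum_congr rfl fun k _ => ?_
  rw [Finset.sum_comm]
  refine Finset.sum_congr rfl fun i _ => ?_
  rw [Finset.sum_comm]
  congr! 2
  ring

namespace IsHessianOn

variable {κ ι : Type*} [Fintype κ] [Fintype ι] [DecidableEq ι] {g : Model κ ι → Matrix ι ι ℝ}
  {U : Set (Model κ ι)}

/-- The holomorphic sectional curvature of the lift of a Hessian metric, on the plane spanned by
`w = (a, b)` and `J w = (-b, a)`. -/
lemma sectionalCurvature_liftMetric (hg : IsHessianOn g U) {Z : Model κ (ι ⊕ ι)}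
    (hZ : basePoint Z ∈ U) (a b : ι → ℝ) :
    sectionalCurvature (liftMetric g) Z (Sum.elim a b) (Sum.elim (-b) a) =
      -hermitianForm (loweredHessianCurvature g (basePoint Z)) a b /
        (inner₁ (g (basePoint Z)) a a + inner₁ (g (basePoint Z)) b b) ^ 2 := by
  have hs : ∀ i j, liftMetric g Z i j = liftMetric g Z j i := by
    rintro (i | i) (j | j) <;> simp [liftMetric, hg.symm hZ i j]
  have hE : IsHessianTensor (loweredHessianCurvature g (basePoint Z)) :=
    ⟨hg.lowered_comm_left hZ, hg.lowered_swap hZ⟩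
  rw [sectionalCurvature, inner₁_curvature hs]
  simp only [hg.lowered_curvature_liftMetric hZ]
  rw [hE.sum_liftLoweredCurvature a b _ _ rfl rfl]
  -- In the denominator, `|Jw| = |w|` and `g(w, Jw) = 0`.
  congr 1
  simp only [liftMetric, inner₁_fromBlocks]
  have hn : ∀ x y : ι → ℝ, inner₁ (g (basePoint Z)) x (-y) = -inner₁ (g (basePoint Z)) x y :=
    fun x y => by simp [inner₁]
  have hn2 : inner₁ (g (basePoint Z)) (-b) (-b) = inner₁ (g (basePoint Z)) b b := by
    simp [inner₁]
  rw [hn2, hn, inner₁_comm (hg.symm hZ) b a]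
  ring

lemma inner₁_pos (hg : IsHessianOn g U) {z : Model κ ι} (hz : z ∈ U) {a : ι → ℝ} (ha : a ≠ 0) :
    0 < inner₁ (g z) a a := by
  have h := (Matrix.posDef_iff_dotProduct_mulVec.1 (hg.posDef z hz)).2 ha
  rw [star_trivial] at h
  refine h.trans_eq ?_
  simp only [inner₁, dotProduct, Matrix.mulVec, Finset.mul_sum]
  refine Finset.sum_congr rfl fun i _ => Finset.sum_congr rfl fun j _ => ?_
  ring

lemma inner₁_nonneg (hg : IsHessianOn g U) {z : Model κ ι} (hz : z ∈ U) (a : ι → ℝ) :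
    0 ≤ inner₁ (g z) a a := by
  rcases eq_or_ne a 0 with rfl | ha
  · simp [inner₁]
  · exact (hg.inner₁_pos hz ha).le

/-- The matrix of `inner₂` on `ι × ι` is the Kronecker square of `g`, which is positive definite. -/
lemma inner₂_pos (hg : IsHessianOn g U) {z : Model κ ι} (hz : z ∈ U) {ξ : Matrix ι ι ℝ}
    (hξ : ξ ≠ 0) : 0 < inner₂ (g z) ξ ξ := by
  have hx : (fun p : ι × ι => ξ p.1 p.2) ≠ 0 := fun h =>
    hξ (Matrix.ext fun i j => congrFun h (i, j))
  have h := (Matrix.posDef_iff_dotProduct_mulVec.1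
    ((hg.posDef z hz).kronecker (hg.posDef z hz))).2 hx
  rw [star_trivial] at h
  refine h.trans_eq ?_
  simp only [inner₂, dotProduct, Matrix.mulVec, Finset.mul_sum,
    Fintype.sum_prod_type, Matrix.kronecker_apply]
  refine Finset.sum_congr rfl fun i _ => Finset.sum_congr rfl fun j _ =>
    Finset.sum_congr rfl fun a _ => Finset.sum_congr rfl fun b _ => ?_
  ring

end IsHessianOn

end TransverseHessian

/-! ### Both curvature conditions as vanishing of the defect tensor -/

namespace TransverseHessian.FoliatedHessianStructure

variable {κ ι : Type*} [Fintype κ] [Fintype ι] [DecidableEq ι]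
  {M : Type*} [TopologicalSpace M] [ChartedSpace (Model κ ι) M]
  [HasGroupoid M (foliationGroupoid κ ι)] (S : FoliatedHessianStructure κ ι M)

/-- The tensor `Q - c G`, where `G` is the tensor of constant Hessian sectional curvature `1`. -/
def curvatureDefect (c : ℝ) (e : (foliationGroupoid κ ι).maximalAtlas M) (z : Model κ ι)
    (l i j k : ι) : ℝ :=
  loweredHessianCurvature (S.g.comp e) z l i j k - c * metricTensor (S.g.comp e z) l i j k

/-- Clear the positive denominator `|ξ|² = G(ξ, ξ)`; at `ξ = 0` both conditions hold trivially. -/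
lemma hasConstantHessianSectionalCurvature_iff (c : ℝ) :
    S.HasConstantHessianSectionalCurvature c ↔
      ∀ e : (foliationGroupoid κ ι).maximalAtlas M, S.D.IsAffineChart e →
        ∀ z ∈ ((adaptedAtlas κ ι M).chart e).target, ∀ ξ : Matrix ι ι ℝ, ξ.IsSymm →
          contract (S.curvatureDefect c e z) ξ ξ = 0 := by
  refine forall_congr' fun e => forall_congr' fun he => forall_congr' fun z =>
    forall_congr' fun hz => forall_congr' fun ξ => forall_congr' fun hξ => ?_
  have h : contract (S.curvatureDefect c e z) ξ ξ =
      contract (loweredHessianCurvature (S.g.comp e) z) ξ ξ - c * inner₂ (S.g.comp e z) ξ ξ := by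
    rw [← contract_metricTensor _ hξ]
    exact contract_sub_smul _ _ _ _ _
  rw [h, hessianSectionalCurvature, S.inner₂_hessianCurvatureOp he hz]
  rcases eq_or_ne ξ 0 with rfl | h0
  · simp [contract, inner₂]
  · rw [div_eq_iff ((S.isHessianOn he).inner₂_pos hz h0).ne', sub_eq_zero]
    simp [h0]

lemma hasConstantHolomorphicCurvature_iff (c : ℝ) :
    S.normalKahlerStructure.HasConstantHolomorphicCurvature (-c) ↔
      ∀ e : (foliationGroupoid κ ι).maximalAtlas M, S.D.IsAffineChart e →
        ∀ z ∈ ((adaptedAtlas κ ι M).chart e).target, ∀ a b : ι → ℝ,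
          hermitianForm (S.curvatureDefect c e z) a b = 0 := by
  have key : ∀ (e : S.AffineChart) (Z : Model κ (ι ⊕ ι)),
      basePoint Z ∈ ((adaptedAtlas κ ι M).chart e.1).target → ∀ a b : ι → ℝ,
      ((Sum.elim a b ≠ 0 → sectionalCurvature (S.normalKahlerStructure.metric.comp e) Z
          (Sum.elim a b) (S.normalKahlerStructure.J e Z *ᵥ Sum.elim a b) = -c) ↔
        hermitianForm (S.curvatureDefect c e.1 (basePoint Z)) a b = 0) := by
    intro e Z hZ a b
    have hg := S.isHessianOn e.2
    have hJ : S.normalKahlerStructure.J e Z *ᵥ Sum.elim a b = Sum.elim (-b) a := by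
      change Matrix.fromBlocks 0 (-1) 1 0 *ᵥ Sum.elim a b = _
      rw [Matrix.fromBlocks_mulVec]
      simp [Matrix.neg_mulVec]
    have hdef : hermitianForm (S.curvatureDefect c e.1 (basePoint Z)) a b =
        hermitianForm (loweredHessianCurvature (S.g.comp e.1) (basePoint Z)) a b -
          c * (inner₁ (S.g.comp e.1 (basePoint Z)) a a +
            inner₁ (S.g.comp e.1 (basePoint Z)) b b) ^ 2 := by
      rw [← hermitianForm_metricTensor (hg.symm hZ)]
      exact hermitianForm_sub_smul _ _ _ _ _
    have hsec : sectionalCurvature (S.normalKahlerStructure.metric.comp e) Z (Sum.elim a b)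
        (Sum.elim (-b) a) = _ := hg.sectionalCurvature_liftMetric hZ a b
    rw [hJ, hsec, hdef]
    -- The zero vector is excluded on the left and gives `0 = 0` on the right.
    by_cases h0 : Sum.elim a b = 0
    · have ha : a = 0 := funext fun i => congrFun h0 (Sum.inl i)
      have hb : b = 0 := funext fun i => congrFun h0 (Sum.inr i)
      subst ha hb
      simp [hermitianForm, inner₁, contract]
    · have hpos : 0 < inner₁ (S.g.comp e.1 (basePoint Z)) a a +
          inner₁ (S.g.comp e.1 (basePoint Z)) b b := by
        rcases eq_or_ne a 0 with ha | ha
        · have hb : b ≠ 0 := by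
            rintro rfl
            apply h0
            rw [ha]
            funext i
            cases i <;> rfl
          exact add_pos_of_nonneg_of_pos (hg.inner₁_nonneg hZ a) (hg.inner₁_pos hZ hb)
        · exact add_pos_of_pos_of_nonneg (hg.inner₁_pos hZ ha) (hg.inner₁_nonneg hZ b)
      rw [neg_div, neg_inj, div_eq_iff (pow_pos hpos 2).ne', sub_eq_zero]
      simp [h0]
  constructor
  · intro h e he z hz a b
    -- The form on the right of `key` depends only on the base point, so testing on the zero section
    -- suffices.
    have hZ : basePoint (reassoc κ ι (z, 0)) = z := by simp [basePoint]
    have hz' : basePoint (reassoc κ ι (z, 0)) ∈ ((adaptedAtlas κ ι M).chart e).target := by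
      rwa [hZ]
    have h1 := (key ⟨e, he⟩ (reassoc κ ι (z, 0)) hz' a b).1 fun h0 =>
      h ⟨e, he⟩ _ (S.affineAtlas.mem_liftChart_target.2 hz') _ h0
    rwa [hZ] at h1
  · intro h e Z hZ w hw
    have hz := S.affineAtlas.mem_liftChart_target.1 hZ
    have h1 := (key e Z hz (w ∘ Sum.inl) (w ∘ Sum.inr)).2 (h e.1 e.2 _ hz _ _)
    rw [Sum.elim_comp_inl_inr] at h1
    exact h1 hw

end TransverseHessian.FoliatedHessianStructure

theorem mainTheorem12 (p q : ℕ) (M : Type*) [TopologicalSpace M]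
    [ChartedSpace (TransverseHessian.Model (Fin p) (Fin q)) M]
    [HasGroupoid M (TransverseHessian.foliationGroupoid (Fin p) (Fin q))]
    (S : TransverseHessian.FoliatedHessianStructure (Fin p) (Fin q) M) (c : ℝ) :
    S.HasConstantHessianSectionalCurvature c ↔
      S.normalKahlerStructure.HasConstantHolomorphicCurvature (-c) := by
  rw [S.hasConstantHessianSectionalCurvature_iff, S.hasConstantHolomorphicCurvature_iff]
  refine forall_congr' fun e => forall_congr' fun he => forall_congr' fun z =>
    forall_congr' fun hz => ?_
  -- Both conditions now concern the same tensor at the same point, so polarization applies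
  -- pointwise.
  exact ((S.isHessianTensor he hz).sub_smul (TransverseHessian.isHessianTensor_metricTensor
    ((S.isHessianOn he).symm hz)) c).contract_eq_zero_iff
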